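/- Let $n \ge 2$ and let $\pm[n]=\{\bar 1,\dots,\bar n,1,\dots,n\}$, where $\bar i=-i$. Let $B_n$ be the hyperoctahedral group, i.e. the group of permutations $w$ of $\pm[n]$ with $w(\bar x)=\overline{w(x)}$ for all $x$. Let $T$ be its set of reflections, i.e. the set of all conjugates in $B_n$ of the simple reflections $(1\ \bar 1)$ and $(i\ i{+}1)(\bar i\ \overline{i{+}1})$, $1\le i<n$. Write $\ell_T(w)$ for the least length of a word in $T$ with product $w$, and let $u\le_T v$ mean $\ell_T(v)=\ell_T(u)+\ell_T(u^{-1}v)$. Fix the Coxeter element $c=(\bar 1\ \bar 2\ \cdots\ \bar n\ 1\ 2\ \cdots\ n)$ and let $NC(B_n,c)=\{w\in B_n : e\le_T w\le_T c\}$, which is a lattice under $\le_T$. For $w\in B_n$ let $\pi_T(w)=\bigvee_{t\in T,\ t\le_T w} t$, the join being taken in $NC(B_n,c)$, let $\mathrm{Pop}_T(w)=w\cdot\pi_T(w)^{-1}$, and let $O_{\mathrm{Pop}_T}(w)=\{w,\mathrm{Pop}_T(w),\mathrm{Pop}_T^2(w),\dots\}$ be the forward orbit of $w$. Order $\pm[n]$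 by $\bar 1\prec\bar 2\prec\cdots\prec\bar n\prec 1\prec 2\prec\cdots\prec n$. An antiexceedance of $w\in B_n$ is an element $x\in\pm[n]$ with $x\prec w^{-1}(x)$. Call $w\in B_n$ *$B$-splittable* if $w$ has exactly $2n-2$ antiexceedances and $\pi_T(w)$, as a permutation of $\pm[n]$, has exactly one non-singleton cycle. Then an element $w\in B_n$ satisfies $|O_{\mathrm{Pop}_T}(w)|=2n-1$ if and only if $w$ is $B$-splittable. In particular, there are exactly $2^n-n-1$ elements $w\in B_n$ with $|O_{\mathrm{Pop}_T}(w)|=2n-1$. -/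

import Mathlib

section AbsoluteOrder

variable {G : Type*} [Group G]

/-- The `T`-word length `ℓ_T(w)`: the least length of a word in `T` with product `w`. -/
noncomputable def wordLength (T : Set G) (w : G) : ℕ :=
  sInf {k | ∃ l : List G, l.length = k ∧ (∀ t ∈ l, t ∈ T) ∧ l.prod = w}

/-- The absolute order `u ≤_T v`. -/
def AbsLE (T : Set G) (u v : G) : Prop :=
  wordLength T v = wordLength T u + wordLength T (u⁻¹ * v)

/-- The interval `[e, c]` of the absolute order. -/
def noncrossing (T : Set G) (c : G) : Set G :=
  {w | AbsLE T 1 w ∧ AbsLE T w c}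

/-- `v` is the join, taken in `[e, c]`, of all `t ∈ T` with `t ≤_T w`. -/
def IsNoncrossingJoin (T : Set G) (c w v : G) : Prop :=
  v ∈ noncrossing T c ∧ (∀ t ∈ T, AbsLE T t w → AbsLE T t v) ∧
    ∀ u ∈ noncrossing T c, (∀ t ∈ T, AbsLE T t w → AbsLE T t u) → AbsLE T v u

open Classical in
/-- The noncrossing projection `π_T(w, c)`, i.e. the join of `IsNoncrossingJoin`. The value `1` is
used only if there is no join, which does not occur for a finite Coxeter group with its set `T` of
reflections and a Coxeter element `c`, where `[e, c]` is a lattice. -/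
noncomputable def noncrossingProj (T : Set G) (c w : G) : G :=
  if h : ∃ v, IsNoncrossingJoin T c w v then h.choose else 1

/-- Coxeter pop-tsack torsing. -/
noncomputable def popT (T : Set G) (c w : G) : G :=
  w * (noncrossingProj T c w)⁻¹

end AbsoluteOrder

/-- The forward orbit `{x, f x, f (f x), …}`. -/
def forwardOrbit {X : Type*} (f : X → X) (x : X) : Set X :=
  Set.range fun k : ℕ => f^[k] x

/-- The set `±[n]` with the total order `1̄ ≺ ⋯ ≺ n̄ ≺ 1 ≺ ⋯ ≺ n`. The left summand is the barred
copy of `[n]`, the right summand the unbarred one; `i : Fin n` stands for the number `i + 1`. -/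
abbrev SignedPt (n : ℕ) : Type := Fin n ⊕ₗ Fin n

namespace SignedPt

variable {n : ℕ}

/-- The element `i + 1` of `±[n]`. -/
def pos (i : Fin n) : SignedPt n := toLex (Sum.inr i)

/-- The element `-(i + 1)` of `±[n]`. -/
def neg (i : Fin n) : SignedPt n := toLex (Sum.inl i)

/-- The negation `x ↦ x̄` on `±[n]`. -/
def bar (x : SignedPt n) : SignedPt n := toLex (Sum.swap (ofLex x))

/-- The elements of `±[n]`, listed as `1̄, …, n̄, 1, …, n`. -/
def points (n : ℕ) : List (SignedPt n) :=
  (List.finRange n).map neg ++ (List.finRange n).map pos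

end SignedPt

open SignedPt in
/-- The hyperoctahedral group `B_n`: the permutations `w` of `±[n]` with `w(x̄) = \overline{w(x)}`. -/
def hyperoctahedral (n : ℕ) : Subgroup (Equiv.Perm (SignedPt n)) where
  carrier := {w | ∀ x, w (bar x) = bar (w x)}
  one_mem' := fun _ => rfl
  mul_mem' := by
    intro a b ha hb x
    simp only [Equiv.Perm.mul_apply]
    rw [hb, ha]
  inv_mem' := by
    intro a ha x
    rw [Equiv.Perm.inv_eq_iff_eq, ha]
    simp

namespace Hyperoctahedral

open SignedPt

variable {n : ℕ}

/-- The simple reflections of `B_n`: `(1 1̄)` and `(i i+1)(ī \overline{i+1})` for `1 ≤ i < n`. -/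
def simpleReflections (n : ℕ) : Set (hyperoctahedral n) :=
  {s | (∃ i : Fin n, (i : ℕ) = 0 ∧
          (s : Equiv.Perm (SignedPt n)) = Equiv.swap (pos i) (neg i)) ∨
       (∃ i j : Fin n, (j : ℕ) = (i : ℕ) + 1 ∧
          (s : Equiv.Perm (SignedPt n)) =
            Equiv.swap (pos i) (pos j) * Equiv.swap (neg i) (neg j))}

/-- The set `T` of all reflections of `B_n`: the conjugates of the simple reflections. -/
def reflections (n : ℕ) : Set (hyperoctahedral n) :=
  Group.conjugatesOfSet (simpleReflections n)

theorem length_points (n : ℕ) : (points n).length = 2 * n := by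
  simp [points]; omega

theorem nodup_points (n : ℕ) : (points n).Nodup := by
  unfold points
  refine List.Nodup.append ?_ ?_ ?_
  · exact (List.nodup_finRange n).map (fun a b h => by simpa [neg] using h)
  · exact (List.nodup_finRange n).map (fun a b h => by simpa [pos] using h)
  · intro x hx hy
    simp only [List.mem_map] at hx hy
    obtain ⟨a, -, rfl⟩ := hx
    obtain ⟨b, -, h⟩ := hy
    simp [pos, neg] at h

theorem mem_points (x : SignedPt n) : x ∈ points n := by
  rcases x with i | i
  · exact List.mem_append_left _ (List.mem_map.2 ⟨i, List.mem_finRange i, rfl⟩)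
  · exact List.mem_append_right _ (List.mem_map.2 ⟨i, List.mem_finRange i, rfl⟩)

theorem bar_points (k : ℕ) (hk : k < (points n).length) :
    bar (points n)[k] = (points n)[(k + n) % (points n).length]'
      (Nat.mod_lt _ (by omega)) := by
  have hl := length_points n
  rcases lt_or_ge k n with h | h
  · have e : (k + n) % (points n).length = k + n := Nat.mod_eq_of_lt (by omega)
    simp only [e]
    simp [points, h, bar, pos, neg]
  · have e : (k + n) % (points n).length = k - n := by
      rw [hl, show k + n = (k - n) + 2 * n by omega, Nat.add_mod_right]
      exact Nat.mod_eq_of_lt (by omega)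
    simp only [e]
    have h1 : ¬ k < n := by omega
    have h2 : k - n < n := by omega
    simp [points, List.getElem_append, h1, h2, bar, pos, neg]

theorem formPerm_points_mem (n : ℕ) : (points n).formPerm ∈ hyperoctahedral n := by
  intro x
  obtain ⟨k, hk, rfl⟩ := List.getElem_of_mem (mem_points x)
  have hl := length_points n
  rw [List.formPerm_apply_getElem _ (nodup_points n), bar_points, bar_points,
    List.formPerm_apply_getElem _ (nodup_points n)]
  congr 1
  simp only [Nat.mod_add_mod]
  congr 1
  omega

/-- The Coxeter element `c = (1̄ 2̄ ⋯ n̄ 1 2 ⋯ n)` of `B_n`, as one cycle. -/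
def coxeterElement (n : ℕ) : hyperoctahedral n :=
  ⟨(points n).formPerm, formPerm_points_mem n⟩

/-- The noncrossing projection `π_T` on `B_n`. -/
noncomputable def piT (w : hyperoctahedral n) : hyperoctahedral n :=
  noncrossingProj (reflections n) (coxeterElement n) w

/-- The operator `Pop_T` on `B_n`. -/
noncomputable def pop (w : hyperoctahedral n) : hyperoctahedral n :=
  popT (reflections n) (coxeterElement n) w

/-- The number of antiexceedances of `w`, i.e. of `x ∈ ±[n]` with `x ≺ w⁻¹(x)`. -/
def aexc (w : hyperoctahedral n) : ℕ :=
  (Finset.univ.filter fun x : SignedPt n => x < (w : Equiv.Perm (SignedPt n))⁻¹ x).card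

/-- The number of non-singleton cycles of `w` as a permutation of `±[n]`. -/
def cyc (w : hyperoctahedral n) : ℕ :=
  (w : Equiv.Perm (SignedPt n)).cycleFactorsFinset.card

/-- `B`-splittable elements. The condition `aexc w = 2n - 2` is written without subtraction. -/
def IsSplittable (w : hyperoctahedral n) : Prop :=
  aexc w + 2 = 2 * n ∧ cyc (piT w) = 1

end Hyperoctahedral

/-!
Enumerate `±[n]` by the integers with period `2n`, so that the bar becomes the shift by `n` and the
Coxeter element `c` the shift by `1`. By Carter's argument the reflection length is the codimension
of the space of odd `w`-invariant functions on `±[n]`, and the elements below `c` are the rotations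
of the bar-stable noncrossing partitions, ordered by refinement. Hence `piT w` rotates the blocks of
the finest such partition that is coarser than the cycles of `w`.

Each nontrivial cycle of `piT w` has exactly one descent, which gives
`aexc w = aexc (pop w) + cyc (piT w)`. So the orbit of `w` has at most `aexc w + 1` elements, with
equality if and only if `piT` has a single nontrivial cycle at every step. Now `aexc w ≤ 2n - 1`,
with equality only for `w = c⁻¹`, whose orbit has `2n` elements. If `aexc w = 2n - 2`, then the
lift of `w⁻¹` to the integers sends `x` to `x + 1` off an `n`-periodic set `S`, and each point of
`S` to the successor of the next point of `S`. When `S` has at least two classes modulo `n`, an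
invariant of this shape persists along the orbit and forces a single block at every step; when it
has only one, `w⁻¹` is `c` times a reflection and `piT w` has two cycles. So splittable elements
correspond to the subsets of `ℤ/n` with at least two elements.
-/

section WordLength

variable {G : Type*} [Group G] {T : Set G}

theorem wordLength_prod_le {l : List G} (hl : ∀ t ∈ l, t ∈ T) : wordLength T l.prod ≤ l.length :=
  Nat.sInf_le ⟨l, rfl, hl, rfl⟩

theorem wordLength_one : wordLength T 1 = 0 :=
  Nat.le_zero.1 (wordLength_prod_le (l := []) (by simp))

theorem wordLength_le_one {t : G} (ht : t ∈ T) : wordLength T t ≤ 1 := by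
  simpa using wordLength_prod_le (l := [t]) (by simpa using ht)

theorem one_absLE (w : G) : AbsLE T 1 w := by
  rw [AbsLE, wordLength_one, inv_one, one_mul, zero_add]

theorem exists_list_length_eq_wordLength (hT : Submonoid.closure T = ⊤) (w : G) :
    ∃ l : List G, l.length = wordLength T w ∧ (∀ t ∈ l, t ∈ T) ∧ l.prod = w := by
  obtain ⟨l, hl, hw⟩ := Submonoid.exists_list_of_mem_closure (hT ▸ Submonoid.mem_top w)
  exact Nat.sInf_mem (s := {k | ∃ l : List G, l.length = k ∧ (∀ t ∈ l, t ∈ T) ∧ l.prod = w})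
    ⟨_, l, rfl, hl, hw⟩

theorem wordLength_mul_le (hT : Submonoid.closure T = ⊤) (u v : G) :
    wordLength T (u * v) ≤ wordLength T u + wordLength T v := by
  obtain ⟨l, hl, hlT, rfl⟩ := exists_list_length_eq_wordLength hT u
  obtain ⟨m, hm, hmT, rfl⟩ := exists_list_length_eq_wordLength hT v
  rw [← hl, ← hm, ← List.prod_append, ← List.length_append]
  refine wordLength_prod_le fun t ht => ?_
  exact (List.mem_append.1 ht).elim (hlT t) (hmT t)

theorem eq_one_of_wordLength_eq_zero (hT : Submonoid.closure T = ⊤) {w : G}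
    (h : wordLength T w = 0) : w = 1 := by
  obtain ⟨l, hl, -, rfl⟩ := exists_list_length_eq_wordLength hT w
  rw [List.length_eq_zero_iff.1 (hl.trans h), List.prod_nil]

theorem exists_wordLength_inv_mul_lt (hT : Submonoid.closure T = ⊤) {w : G} (hw : w ≠ 1) :
    ∃ t ∈ T, wordLength T (t⁻¹ * w) < wordLength T w := by
  obtain ⟨l, hl, hlT, rfl⟩ := exists_list_length_eq_wordLength hT w
  match l, hl, hlT, hw with
  | [], _, _, hw => exact absurd List.prod_nil hw
  | t :: l, hl, hlT, _ =>
    refine ⟨t, hlT t List.mem_cons_self, ?_⟩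
    rw [← hl, List.prod_cons, inv_mul_cancel_left, List.length_cons, Nat.lt_succ_iff]
    exact wordLength_prod_le fun s hs => hlT s (List.mem_cons_of_mem t hs)

theorem wordLength_conj_le (hT : Submonoid.closure T = ⊤) (hconj : ∀ g, ∀ t ∈ T, g * t * g⁻¹ ∈ T)
    (g w : G) : wordLength T (g * w * g⁻¹) ≤ wordLength T w := by
  obtain ⟨l, hl, hlT, rfl⟩ := exists_list_length_eq_wordLength hT w
  rw [← hl, ← MulAut.conj_apply, map_list_prod, ← List.length_map (MulAut.conj g)]
  refine wordLength_prod_le fun s hs => ?_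
  obtain ⟨t, ht, rfl⟩ := List.mem_map.1 hs
  exact hconj g t (hlT t ht)

theorem wordLength_mul_comm (hT : Submonoid.closure T = ⊤)
    (hconj : ∀ g, ∀ t ∈ T, g * t * g⁻¹ ∈ T) (u v : G) :
    wordLength T (u * v) = wordLength T (v * u) := by
  have le_swap : ∀ u v : G, wordLength T (u * v) ≤ wordLength T (v * u) := fun u v => by
    simpa [mul_assoc] using wordLength_conj_le hT hconj u (v * u)
  exact (le_swap u v).antisymm (le_swap v u)

section Descent

variable {d : G → ℕ}

theorem closure_eq_top_of_descent (descent : ∀ w ≠ 1, ∃ t ∈ T, d (t⁻¹ * w) < d w) :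
    Submonoid.closure T = ⊤ := by
  refine (Submonoid.eq_top_iff' _).2 fun w => ?_
  induction hk : d w using Nat.strong_induction_on generalizing w with
  | _ k ih =>
    by_cases hw : w = 1
    · exact hw ▸ one_mem _
    obtain ⟨t, ht, hlt⟩ := descent w hw
    rw [← mul_inv_cancel_left t w]
    exact mul_mem (Submonoid.subset_closure ht) (ih _ (hk ▸ hlt) _ rfl)

theorem wordLength_le_of_descent (descent : ∀ w ≠ 1, ∃ t ∈ T, d (t⁻¹ * w) < d w) (w : G) :
    wordLength T w ≤ d w := by
  induction hk : d w using Nat.strong_induction_on generalizing w with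
  | _ k ih =>
    by_cases hw : w = 1
    · rw [hw, wordLength_one]
      exact Nat.zero_le k
    obtain ⟨t, ht, hlt⟩ := descent w hw
    have h₁ := ih _ (hk ▸ hlt) (t⁻¹ * w) rfl
    have h₂ := wordLength_mul_le (closure_eq_top_of_descent descent) t (t⁻¹ * w)
    have h₃ := wordLength_le_one ht
    rw [mul_inv_cancel_left] at h₂
    omega

theorem le_wordLength (hT : Submonoid.closure T = ⊤) (one : d 1 = 0)
    (mul_le : ∀ t ∈ T, ∀ w, d (t * w) ≤ d w + 1) (w : G) : d w ≤ wordLength T w := by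
  obtain ⟨l, hl, hlT, rfl⟩ := exists_list_length_eq_wordLength hT w
  rw [← hl]
  clear hl
  induction l with
  | nil => simp [one]
  | cons t l ih =>
    rw [List.forall_mem_cons] at hlT
    rw [List.prod_cons, List.length_cons]
    exact (mul_le t hlT.1 _).trans (Nat.succ_le_succ (ih hlT.2))

end Descent

theorem AbsLE.antisymm (hT : Submonoid.closure T = ⊤) {u v : G} (h : AbsLE T u v)
    (h' : AbsLE T v u) : u = v := by
  unfold AbsLE at h h'
  exact inv_mul_eq_one.1 (eq_one_of_wordLength_eq_zero hT (by omega))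

theorem absLE_of_wordLength_lt (hT : Submonoid.closure T = ⊤) {t w : G} (ht : t ∈ T)
    (h : wordLength T (t⁻¹ * w) < wordLength T w) : AbsLE T t w := by
  have h₁ := wordLength_mul_le hT t (t⁻¹ * w)
  have h₂ := wordLength_le_one ht
  rw [mul_inv_cancel_left] at h₁
  unfold AbsLE
  omega

theorem AbsLE.wordLength_eq (hT : Submonoid.closure T = ⊤) (hconj : ∀ g, ∀ t ∈ T, g * t * g⁻¹ ∈ T)
    {t w : G} (h : AbsLE T t w) : wordLength T w = wordLength T t + wordLength T (w * t⁻¹) := by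
  rw [h, wordLength_mul_comm hT hconj]

theorem AbsLE.of_mul_inv (hT : Submonoid.closure T = ⊤) (hconj : ∀ g, ∀ t ∈ T, g * t * g⁻¹ ∈ T)
    {t u v : G} (hu : AbsLE T t u) (hv : AbsLE T t v) (h : AbsLE T (u * t⁻¹) (v * t⁻¹)) :
    AbsLE T u v := by
  have h₁ := hu.wordLength_eq hT hconj
  have h₂ := hv.wordLength_eq hT hconj
  rw [AbsLE, mul_inv_rev, inv_inv, mul_assoc t, wordLength_mul_comm hT hconj t,
    ← mul_assoc, inv_mul_cancel_right] at h
  unfold AbsLE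
  omega

theorem AbsLE.induction (hT : Submonoid.closure T = ⊤) (hconj : ∀ g, ∀ t ∈ T, g * t * g⁻¹ ∈ T)
    {p : G → Prop} {u v : G} (h : AbsLE T u v) (top : p v)
    (step : ∀ w, ∀ t ∈ T, AbsLE T t w → p w → p (w * t⁻¹)) : p u := by
  induction hk : wordLength T (u⁻¹ * v) using Nat.strong_induction_on generalizing u with
  | _ k ih =>
    by_cases huv : u = v
    · exact huv ▸ top
    obtain ⟨t, ht, hlt⟩ := exists_wordLength_inv_mul_lt hT (w := u⁻¹ * v)
      (fun h => huv (inv_mul_eq_one.1 h))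
    rw [← mul_assoc, ← mul_inv_rev] at hlt
    have h₁ := wordLength_mul_le hT (u * t) ((u * t)⁻¹ * v)
    have h₂ := wordLength_mul_le hT u t
    have h₃ := wordLength_le_one ht
    rw [mul_inv_cancel_left] at h₁
    have hle : AbsLE T (u * t) v := by
      unfold AbsLE at h ⊢
      omega
    have htle : AbsLE T t (u * t) := by
      rw [AbsLE, wordLength_mul_comm hT hconj t⁻¹, mul_inv_cancel_right]
      unfold AbsLE at h
      omega
    simpa using step _ t ht htle (ih _ (hk ▸ hlt) hle rfl)

end WordLength

namespace SignedPt

variable {n : ℕ}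

theorem pos_injective : Function.Injective (pos : Fin n → SignedPt n) := Sum.inr_injective

theorem pos_ne_neg (i j : Fin n) : pos i ≠ neg j := Sum.inr_ne_inl

theorem bar_bar (x : SignedPt n) : bar (bar x) = x := by
  rcases x with i | i <;> rfl

theorem bar_eq_iff (x y : SignedPt n) : bar x = y ↔ x = bar y :=
  ⟨fun h => by rw [← h, bar_bar], fun h => by rw [h, bar_bar]⟩

theorem bar_ne (x : SignedPt n) : bar x ≠ x := by
  rcases x with i | i
  · exact Sum.inr_ne_inl
  · exact Sum.inl_ne_inr

theorem pairwise_lt_points (n : ℕ) : (points n).Pairwise (· < ·) := by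
  unfold points
  have h := List.pairwise_lt_finRange n
  refine List.pairwise_append.2 ⟨?_, ?_, ?_⟩
  · exact List.pairwise_map.2 (h.imp fun hab => Sum.Lex.inl_lt_inl_iff.2 hab)
  · exact List.pairwise_map.2 (h.imp fun hab => Sum.Lex.inr_lt_inr_iff.2 hab)
  · intro a ha b hb
    obtain ⟨i, -, rfl⟩ := List.mem_map.1 ha
    obtain ⟨j, -, rfl⟩ := List.mem_map.1 hb
    exact Sum.Lex.inl_lt_inr _ _

variable [NeZero n]

theorem two_mul_pos (n : ℕ) [NeZero n] : (0 : ℤ) < 2 * n := by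
  have := NeZero.pos n
  omega

theorem toNat_emod_lt (x : ℤ) : (x % (2 * n)).toNat < (points n).length := by
  have h := Int.emod_lt_of_pos x (two_mul_pos n)
  have h' := Int.emod_nonneg x (two_mul_pos n).ne'
  rw [Hyperoctahedral.length_points]
  omega

/-- The `2n`-periodic enumeration `1̄, …, n̄, 1, …, n, 1̄, …` of `±[n]` by the integers, with
`ofInt 0 = 1̄`. The bar is the shift by `n` and the Coxeter element is the shift by `1`. -/
def ofInt (x : ℤ) : SignedPt n := (points n)[(x % (2 * n)).toNat]'(toNat_emod_lt x)

theorem ofInt_eq_iff_emod {x y : ℤ} :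
    (ofInt x : SignedPt n) = ofInt y ↔ x % (2 * n) = y % (2 * n) := by
  unfold ofInt
  rw [(Hyperoctahedral.nodup_points n).getElem_inj_iff]
  have h := Int.emod_nonneg x (two_mul_pos n).ne'
  have h' := Int.emod_nonneg y (two_mul_pos n).ne'
  omega

theorem ofInt_eq_iff {x y : ℤ} :
    (ofInt x : SignedPt n) = ofInt y ↔ ∃ k : ℤ, y = x + 2 * n * k := by
  rw [ofInt_eq_iff_emod, ← Int.ModEq, Int.modEq_iff_dvd]
  exact ⟨fun ⟨k, hk⟩ => ⟨k, by linarith⟩, fun ⟨k, hk⟩ => ⟨k, by linarith⟩⟩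

theorem ofInt_add_mul (x k : ℤ) : (ofInt (x + 2 * n * k) : SignedPt n) = ofInt x :=
  (ofInt_eq_iff.2 ⟨k, rfl⟩).symm

theorem ofInt_add_two_mul (x : ℤ) : (ofInt (x + 2 * n) : SignedPt n) = ofInt x := by
  simpa using ofInt_add_mul (n := n) x 1

theorem apply_eq_of_ofInt_eq {β : Type*} {g : ℤ → β} (hg : Function.Periodic g (2 * n)) {x y : ℤ}
    (h : (ofInt x : SignedPt n) = ofInt y) : g x = g y := by
  obtain ⟨k, rfl⟩ := ofInt_eq_iff.1 h
  rw [mul_comm]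
  exact (hg.int_mul k x).symm

theorem eq_of_ofInt_eq {x y : ℤ} (h : (ofInt x : SignedPt n) = ofInt y)
    (h₁ : x < y + 2 * n) (h₂ : y < x + 2 * n) : x = y := by
  obtain ⟨k, rfl⟩ := ofInt_eq_iff.1 h
  have k_eq : k = 0 := by nlinarith [two_mul_pos n]
  simp [k_eq]

theorem exists_ofInt_window (m : ℤ) (p : SignedPt n) :
    ∃ x, m ≤ x ∧ x < m + 2 * n ∧ ofInt x = p := by
  obtain ⟨k, hk, rfl⟩ := List.getElem_of_mem (Hyperoctahedral.mem_points p)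
  have hn := two_mul_pos n
  refine ⟨m + ((k : ℤ) - m) % (2 * n), ?_, ?_, ?_⟩
  · have := Int.emod_nonneg ((k : ℤ) - m) hn.ne'
    omega
  · have := Int.emod_lt_of_pos ((k : ℤ) - m) hn
    omega
  · rw [Hyperoctahedral.length_points] at hk
    have : (m + ((k : ℤ) - m) % (2 * n)) % (2 * n) = k := by
      rw [Int.add_emod_emod, add_sub_cancel]
      exact Int.emod_eq_of_lt (by omega) (by omega)
    simp only [ofInt, this, Int.toNat_natCast]

theorem ofInt_surjective : Function.Surjective (ofInt : ℤ → SignedPt n) := fun p => by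
  obtain ⟨x, -, -, h⟩ := exists_ofInt_window 0 p
  exact ⟨x, h⟩

theorem ofInt_add_self (x : ℤ) : (ofInt (x + n) : SignedPt n) = bar (ofInt x) := by
  unfold ofInt
  rw [Hyperoctahedral.bar_points]
  congr 1
  have h := Int.emod_nonneg x (two_mul_pos n).ne'
  have h' := Int.emod_nonneg (x + n) (two_mul_pos n).ne'
  rw [Hyperoctahedral.length_points]
  zify
  rw [Int.toNat_of_nonneg h, Int.toNat_of_nonneg h', Int.emod_add_emod]

theorem ofInt_lt_iff {x y : ℤ} (hx : 0 ≤ x) (hx' : x < 2 * n) (hy : 0 ≤ y) (hy' : y < 2 * n) :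
    (ofInt x : SignedPt n) < ofInt y ↔ x < y := by
  have lt_of_lt : ∀ a b : ℤ, 0 ≤ a → a < 2 * n → 0 ≤ b → b < 2 * n → a < b →
      (ofInt a : SignedPt n) < ofInt b := by
    intro a b ha ha' hb hb' hab
    unfold ofInt
    refine List.pairwise_iff_getElem.1 (pairwise_lt_points n) _ _ _ _ ?_
    rw [Int.emod_eq_of_lt ha ha', Int.emod_eq_of_lt hb hb']
    omega
  refine ⟨fun h => ?_, lt_of_lt x y hx hx' hy hy'⟩
  rcases lt_trichotomy x y with h' | h' | h'
  · exact h'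
  · rw [h'] at h
    exact absurd h (lt_irrefl _)
  · exact absurd (lt_of_lt y x hy hy' hx hx' h') (lt_asymm h)

theorem coxeterElement_ofInt (x : ℤ) :
    (Hyperoctahedral.coxeterElement n : Equiv.Perm (SignedPt n)) (ofInt x) = ofInt (x + 1) := by
  unfold ofInt
  change (points n).formPerm _ = _
  rw [List.formPerm_apply_getElem _ (Hyperoctahedral.nodup_points n)]
  congr 1
  have h := Int.emod_nonneg x (two_mul_pos n).ne'
  have h' := Int.emod_nonneg (x + 1) (two_mul_pos n).ne'
  rw [Hyperoctahedral.length_points]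
  zify
  rw [Int.toNat_of_nonneg h, Int.toNat_of_nonneg h', Int.emod_add_emod]

end SignedPt

namespace Hyperoctahedral

open SignedPt

variable {n : ℕ}

theorem ext_apply {u v : hyperoctahedral n} (h : ∀ x, u.1 x = v.1 x) : u = v :=
  Subtype.ext (Equiv.ext h)

theorem mul_apply (u v : hyperoctahedral n) (x : SignedPt n) : (u * v).1 x = u.1 (v.1 x) := rfl

theorem inv_apply_eq_iff {w : hyperoctahedral n} {x y : SignedPt n} :
    (w⁻¹).1 x = y ↔ x = w.1 y :=
  Equiv.Perm.inv_eq_iff_eq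

theorem apply_bar (w : hyperoctahedral n) (x : SignedPt n) : w.1 (bar x) = bar (w.1 x) := w.2 x

theorem exists_apply_ne {w : hyperoctahedral n} (hw : w ≠ 1) : ∃ x, w.1 x ≠ x := by
  by_contra! h
  exact hw (ext_apply h)

section OfInt

variable [NeZero n]

theorem ext_ofInt {u v : hyperoctahedral n} (h : ∀ x, u.1 (ofInt x) = v.1 (ofInt x)) : u = v :=
  ext_apply <| ofInt_surjective.forall.2 h

theorem periodic_ofInt_comp {f : ℤ → ℤ} (add_self : ∀ x, f (x + n) = f x + n) :
    Function.Periodic (fun x => (ofInt (f x) : SignedPt n)) (2 * n) := fun x => by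
  simp only
  rw [two_mul, ← add_assoc, add_self, add_self, add_assoc, ← two_mul, ofInt_add_two_mul]

theorem exists_forall_apply_ofInt {f : ℤ → ℤ} (add_self : ∀ x, f (x + n) = f x + n)
    (inj : ∀ x y, (ofInt (f x) : SignedPt n) = ofInt (f y) → (ofInt x : SignedPt n) = ofInt y) :
    ∃ w : hyperoctahedral n, ∀ x, w.1 (ofInt x) = ofInt (f x) := by
  let F : SignedPt n → SignedPt n := fun p => ofInt (f (Function.surjInv ofInt_surjective p))
  have apply_ofInt : ∀ x, F (ofInt x) = ofInt (f x) := fun x =>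
    apply_eq_of_ofInt_eq (periodic_ofInt_comp add_self)
      (Function.surjInv_eq ofInt_surjective (ofInt x))
  have bijective : Function.Bijective F := Finite.injective_iff_bijective.1 <|
    ofInt_surjective.forall₂.2 fun x y h => inj x y (by rwa [apply_ofInt, apply_ofInt] at h)
  refine ⟨⟨Equiv.ofBijective F bijective, ofInt_surjective.forall.2 fun x => ?_⟩, apply_ofInt⟩
  change F (bar (ofInt x)) = bar (F (ofInt x))
  rw [← ofInt_add_self, apply_ofInt, apply_ofInt, add_self, ofInt_add_self]

end OfInt

section Refl

/-- The map underlying the reflection `refl x y`. -/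
def reflFun (x y z : SignedPt n) : SignedPt n :=
  if z = x then y else if z = y then x else if z = bar x then bar y else
    if z = bar y then bar x else z

theorem reflFun_involutive (x y : SignedPt n) : Function.Involutive (reflFun x y) := by
  intro z
  grind [reflFun, bar_bar, bar_ne]

theorem reflFun_bar (x y z : SignedPt n) : reflFun x y (bar z) = bar (reflFun x y z) := by
  grind [reflFun, bar_bar, bar_ne]

/-- The element of `B_n` that exchanges `x` with `y` and `x̄` with `ȳ`. For `x ≠ y` these are
exactly the reflections. -/
def refl (x y : SignedPt n) : hyperoctahedral n :=
  ⟨(reflFun_involutive x y).toPerm, reflFun_bar x y⟩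

theorem refl_apply (x y z : SignedPt n) : (refl x y).1 z =
    if z = x then y else if z = y then x else if z = bar x then bar y else
    if z = bar y then bar x else z := rfl

theorem refl_left (x y : SignedPt n) : (refl x y).1 x = y := by simp [refl_apply]

theorem refl_refl (x y z : SignedPt n) : (refl x y).1 ((refl x y).1 z) = z :=
  reflFun_involutive x y z

theorem refl_right (x y : SignedPt n) : (refl x y).1 y = x := by
  simpa only [refl_left] using refl_refl x y x

theorem refl_of_ne {x y z : SignedPt n} (hx : z ≠ x) (hy : z ≠ y) (hx' : z ≠ bar x)
    (hy' : z ≠ bar y) : (refl x y).1 z = z := by simp [refl_apply, *]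

theorem refl_mul_self (x y : SignedPt n) : refl x y * refl x y = 1 := ext_apply (refl_refl x y)

theorem refl_inv (x y : SignedPt n) : (refl x y)⁻¹ = refl x y :=
  inv_eq_of_mul_eq_one_left (refl_mul_self x y)

theorem refl_comm (x y : SignedPt n) : refl x y = refl y x := by
  refine ext_apply fun z => ?_
  rw [refl_apply, refl_apply]
  split_ifs <;> simp_all

theorem conj_refl (w : hyperoctahedral n) (x y : SignedPt n) :
    w * refl x y * w⁻¹ = refl (w.1 x) (w.1 y) := by
  rw [mul_inv_eq_iff_eq_mul]
  refine ext_apply fun z => ?_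
  simp only [mul_apply, refl_apply, ← apply_bar, EmbeddingLike.apply_eq_iff_eq]
  split_ifs <;> rfl

theorem refl_pos_neg (i : Fin n) :
    (refl (pos i) (neg i)).1 = Equiv.swap (pos i) (neg i) := by
  ext z : 1
  have h₁ : bar (pos i) = neg i := rfl
  have h₂ : bar (neg i) = pos i := rfl
  rw [refl_apply, Equiv.swap_apply_def, h₁, h₂]
  split_ifs <;> simp_all

theorem refl_pos_pos {i j : Fin n} (hij : i ≠ j) : (refl (pos i) (pos j)).1 =
    Equiv.swap (pos i) (pos j) * Equiv.swap (neg i) (neg j) := by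
  ext z : 1
  have h₁ : bar (pos i) = neg i := rfl
  have h₂ : bar (pos j) = neg j := rfl
  have : ∀ k l : Fin n, pos k ≠ neg l := pos_ne_neg
  have : ∀ k l : Fin n, neg k ≠ pos l := fun k l => (pos_ne_neg l k).symm
  have : neg i ≠ neg j := fun h => hij (Sum.inl_injective h)
  have : pos i ≠ pos j := fun h => hij (pos_injective h)
  rw [refl_apply, Equiv.Perm.mul_apply, Equiv.swap_apply_def, Equiv.swap_apply_def, h₁, h₂]
  split_ifs <;> simp_all

theorem conj_mem_reflections (w : hyperoctahedral n) (t : hyperoctahedral n)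
    (ht : t ∈ reflections n) : w * t * w⁻¹ ∈ reflections n :=
  Group.conj_mem_conjugatesOfSet ht

theorem exists_refl_of_mem {t : hyperoctahedral n} (ht : t ∈ reflections n) :
    ∃ x y, x ≠ y ∧ t = refl x y := by
  obtain ⟨s, hs, hst⟩ := Group.mem_conjugatesOfSet_iff.1 ht
  obtain ⟨w, rfl⟩ := isConj_iff.1 hst
  rcases hs with ⟨i, -, hi⟩ | ⟨i, j, hij, h⟩
  · rw [show s = _ from Subtype.ext (hi.trans (refl_pos_neg i).symm), conj_refl]
    exact ⟨_, _, fun h => pos_ne_neg _ _ (w.1.injective h), rfl⟩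
  · have hne : i ≠ j := fun h => by
      rw [h] at hij
      omega
    rw [show s = _ from Subtype.ext (h.trans (refl_pos_pos hne).symm), conj_refl]
    exact ⟨_, _, fun h => hne (pos_injective (w.1.injective h)), rfl⟩

theorem refl_self_bar_mem_reflections (x : SignedPt n) : refl x (bar x) ∈ reflections n := by
  have : 0 < n := by rcases x with i | i <;> exact i.pos
  let o : Fin n := ⟨0, this⟩
  have ho : refl (pos o) (bar (pos o)) ∈ reflections n :=
    Group.subset_conjugatesOfSet (Or.inl ⟨o, rfl, refl_pos_neg o⟩)
  have h := conj_mem_reflections (refl (pos o) x) _ ho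
  rwa [conj_refl, apply_bar, refl_left] at h

theorem one_lt_of_ne {x y : SignedPt n} (hxy : x ≠ y) (hy : y ≠ bar x) : 1 < n := by
  by_contra! hn
  have : Subsingleton (Fin n) := Fin.subsingleton_iff_le_one.2 hn
  rcases x with i | i <;> rcases y with j | j <;> rw [Subsingleton.elim i j] at hxy hy
  · exact hxy rfl
  · exact hy rfl
  · exact hy rfl
  · exact hxy rfl

theorem refl_mem_reflections {x y : SignedPt n} (hxy : x ≠ y) : refl x y ∈ reflections n := by
  by_cases hy : y = bar x
  · exact hy ▸ refl_self_bar_mem_reflections x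
  have hn := one_lt_of_ne hxy hy
  let o : Fin n := ⟨0, by omega⟩
  let i : Fin n := ⟨1, hn⟩
  have hoi : o ≠ i := by simp [o, i]
  have simple_mem : refl (pos o) (pos i) ∈ reflections n :=
    Group.subset_conjugatesOfSet (Or.inr ⟨o, i, rfl, refl_pos_pos hoi⟩)
  -- Conjugation moves `pos o` to `x` and `pos i` to some `z`; a second one moves `z` to `y`.
  let w := refl (pos o) x
  have h := conj_mem_reflections (refl (w.1 (pos i)) y) _ (conj_mem_reflections w _ simple_mem)
  have hwo : w.1 (pos o) = x := refl_left _ _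
  have hz : x ≠ w.1 (pos i) := hwo ▸ fun h => hoi (pos_injective (w.1.injective h))
  have hz' : x ≠ bar (w.1 (pos i)) := by
    rw [← hwo, ← apply_bar]
    exact fun h => pos_ne_neg _ _ (w.1.injective h)
  rw [conj_refl, conj_refl, hwo, refl_left] at h
  rwa [refl_of_ne hz hxy hz' (fun h => hy ((bar_eq_iff x y).2 h).symm)] at h

end Refl

section FixedSpace

/-- The odd functions on `±[n]` that are invariant under `w`. Odd functions form the reflection
representation of `B_n`, so this is the fixed space of `w`. -/
def fixOdd (w : hyperoctahedral n) : Submodule ℚ (SignedPt n → ℚ) where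
  carrier := {g | (∀ x, g (bar x) = -g x) ∧ ∀ x, g (w.1 x) = g x}
  add_mem' := by
    rintro g h ⟨hg, hg'⟩ ⟨hh, hh'⟩
    exact ⟨fun x => by simp only [Pi.add_apply, hg, hh, neg_add],
      fun x => by simp only [Pi.add_apply, hg', hh']⟩
  zero_mem' := ⟨fun x => by simp, fun x => rfl⟩
  smul_mem' := by
    rintro a g ⟨hg, hg'⟩
    exact ⟨fun x => by simp only [Pi.smul_apply, hg, smul_neg],
      fun x => by simp only [Pi.smul_apply, hg']⟩

/-- The dimension of the fixed space of `w`. -/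
noncomputable def fixDim (w : hyperoctahedral n) : ℕ := Module.finrank ℚ (fixOdd w)

theorem fixOdd_le_one (w : hyperoctahedral n) : fixOdd w ≤ fixOdd 1 :=
  fun _ hg => ⟨hg.1, fun _ => rfl⟩

/-- The coordinates of the reflection representation: an odd function is determined by its values
on the unbarred points. -/
def oddEquiv (n : ℕ) : fixOdd (1 : hyperoctahedral n) ≃ₗ[ℚ] (Fin n → ℚ) where
  toFun g i := g.1 (pos i)
  map_add' _ _ := rfl
  map_smul' _ _ := rfl
  invFun h := ⟨fun x => Sum.elim (fun i => -h i) h (ofLex x), by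
    refine ⟨fun x => ?_, fun x => rfl⟩
    rcases x with i | i
    · exact (neg_neg _).symm
    · rfl⟩
  left_inv g := by
    apply Subtype.ext
    funext x
    rcases x with i | i
    · exact (g.2.1 (pos i)).symm
    · rfl
  right_inv h := rfl

theorem fixDim_one : fixDim (1 : hyperoctahedral n) = n := by
  rw [fixDim, (oddEquiv n).finrank_eq, Module.finrank_fin_fun]

theorem fixDim_le (w : hyperoctahedral n) : fixDim w ≤ n :=
  (Submodule.finrank_mono (fixOdd_le_one w)).trans_eq fixDim_one

theorem inf_fixOdd_le (u v : hyperoctahedral n) : fixOdd u ⊓ fixOdd v ≤ fixOdd (u * v) :=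
  fun _ hg => ⟨hg.1.1, fun x => (hg.1.2 (v.1 x)).trans (hg.2.2 x)⟩

theorem fixDim_add_le_inf (u v : hyperoctahedral n) :
    fixDim u + fixDim v ≤ Module.finrank ℚ ↑(fixOdd u ⊓ fixOdd v) + n := by
  have h := Submodule.finrank_sup_add_finrank_inf_eq (fixOdd u) (fixOdd v)
  have h' : Module.finrank ℚ ↑(fixOdd u ⊔ fixOdd v) ≤ n :=
    (Submodule.finrank_mono (sup_le (fixOdd_le_one u) (fixOdd_le_one v))).trans_eq fixDim_one
  unfold fixDim
  omega

theorem fixDim_add_le_mul (u v : hyperoctahedral n) :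
    fixDim u + fixDim v ≤ fixDim (u * v) + n :=
  (fixDim_add_le_inf u v).trans
    (Nat.add_le_add_right (Submodule.finrank_mono (inf_fixOdd_le u v)) n)

theorem fixOdd_mul_eq_inf {u v : hyperoctahedral n}
    (h : fixDim u + fixDim v = fixDim (u * v) + n) : fixOdd (u * v) = fixOdd u ⊓ fixOdd v := by
  refine (Submodule.eq_of_le_of_finrank_le (inf_fixOdd_le u v) ?_).symm
  have := fixDim_add_le_inf u v
  unfold fixDim at *
  omega

theorem mem_fixOdd_refl {x y : SignedPt n} {g : SignedPt n → ℚ} :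
    g ∈ fixOdd (refl x y) ↔ g ∈ fixOdd (1 : hyperoctahedral n) ∧ g x = g y := by
  constructor
  · intro hg
    exact ⟨fixOdd_le_one _ hg, by rw [← hg.2 x, refl_left]⟩
  · rintro ⟨hg, hxy⟩
    refine ⟨hg.1, fun z => ?_⟩
    have hx := hg.1 x
    have hy := hg.1 y
    rw [refl_apply]
    split_ifs <;> simp_all

theorem le_fixDim_refl_add_one (x y : SignedPt n) : n ≤ fixDim (refl x y) + 1 := by
  let φ := (LinearMap.proj x : (SignedPt n → ℚ) →ₗ[ℚ] ℚ) - LinearMap.proj y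
  have fixOdd_eq : fixOdd (refl x y) = fixOdd 1 ⊓ LinearMap.ker φ := by
    ext g
    rw [mem_fixOdd_refl, Submodule.mem_inf, LinearMap.mem_ker]
    simp [φ, sub_eq_zero]
  have h₁ := Submodule.finrank_sup_add_finrank_inf_eq (fixOdd (1 : hyperoctahedral n))
    (LinearMap.ker φ)
  have h₂ := LinearMap.finrank_range_add_finrank_ker φ
  have h₃ : Module.finrank ℚ (LinearMap.range φ) ≤ 1 := by
    simpa using Submodule.finrank_le (LinearMap.range φ)
  have h₄ := Submodule.finrank_le (fixOdd (1 : hyperoctahedral n) ⊔ LinearMap.ker φ)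
  have h₅ := fixDim_one (n := n)
  unfold fixDim at *
  rw [fixOdd_eq]
  omega

/-- The coordinate vector `e_x` of the reflection representation, with `e_x̄ = -e_x`. -/
def oddDelta (x z : SignedPt n) : ℚ :=
  (if z = x then 1 else 0) - if z = bar x then 1 else 0

theorem oddDelta_bar (x z : SignedPt n) : oddDelta x (bar z) = -oddDelta x z := by
  simp only [oddDelta, bar_eq_iff, bar_bar, neg_sub]

theorem oddDelta_apply (w : hyperoctahedral n) (x z : SignedPt n) :
    oddDelta (w.1 x) (w.1 z) = oddDelta x z := by
  simp only [oddDelta, ← apply_bar, EmbeddingLike.apply_eq_iff_eq]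

/-- The root `e_x - e_y` of the reflection `refl x y`. -/
def root (x y z : SignedPt n) : ℚ := oddDelta x z - oddDelta y z

theorem root_bar (x y z : SignedPt n) : root x y (bar z) = -root x y z := by
  simp only [root, oddDelta_bar, neg_sub_neg, neg_sub]

theorem root_left_pos {x y : SignedPt n} (hxy : x ≠ y) : 0 < root x y x := by
  have := bar_ne x
  grind [root, oddDelta]

theorem root_left_sub_right_pos {x y : SignedPt n} (hxy : x ≠ y) :
    0 < root x y x - root x y y := by
  have hx := root_left_pos hxy
  have hy := root_left_pos hxy.symm
  simp only [root] at *
  linarith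

theorem sum_mul_root {g : SignedPt n → ℚ} (hg : ∀ z, g (bar z) = -g z) (x y : SignedPt n) :
    ∑ z, g z * root x y z = 2 * (g x - g y) := by
  simp only [root, oddDelta, mul_sub, mul_ite, mul_one, mul_zero, Finset.sum_sub_distrib,
    Finset.sum_ite_eq', Finset.mem_univ, if_true, hg]
  ring

/-- The formula `s_α(g) = g - 2 ⟨g, α⟩ / ⟨α, α⟩ α` for `α = root x y`, cleared of denominators. -/
theorem root_mul_apply_refl {g : SignedPt n → ℚ} (hg : ∀ z, g (bar z) = -g z)
    (x y z : SignedPt n) : (root x y x - root x y y) * (g ((refl x y).1 z) - g z) =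
      -2 * (g x - g y) * root x y z := by
  grind [root, oddDelta, refl_apply, bar_bar, bar_ne]

/-- The root of `refl x y` is moved by `w`: it lies in the image of `w - 1` on the reflection
representation. -/
def MovRel (w : hyperoctahedral n) (x y : SignedPt n) : Prop :=
  ∃ β : SignedPt n → ℚ, (∀ z, β (bar z) = -β z) ∧ ∀ z, β z - β (w.1 z) = root y x (w.1 z)

theorem movRel_self {w : hyperoctahedral n} {x : SignedPt n} : MovRel w x x :=
  ⟨0, by simp, by simp [root]⟩

theorem MovRel.trans {w : hyperoctahedral n} {x y z : SignedPt n} (h : MovRel w x y)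
    (h' : MovRel w y z) : MovRel w x z := by
  obtain ⟨β, hβ, h⟩ := h
  obtain ⟨γ, hγ, h'⟩ := h'
  refine ⟨β + γ, fun z => by simp only [Pi.add_apply, hβ, hγ, neg_add], fun z => ?_⟩
  simp only [Pi.add_apply, root] at *
  linarith [h z, h' z]

theorem movRel_apply (w : hyperoctahedral n) (x : SignedPt n) : MovRel w x (w.1 x) :=
  ⟨oddDelta x, oddDelta_bar x, fun z => by rw [root, oddDelta_apply]⟩

theorem movRel_of_sameCycle {w : hyperoctahedral n} {x y : SignedPt n}
    (h : w.1.SameCycle x y) : MovRel w x y := by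
  obtain ⟨k, rfl⟩ := h.exists_nat_pow_eq
  clear h
  induction k with
  | zero => exact movRel_self
  | succ k ih =>
    rw [pow_succ', Equiv.Perm.mul_apply]
    exact ih.trans (movRel_apply w _)

theorem MovRel.fixOdd_le {w : hyperoctahedral n} {x y : SignedPt n} (h : MovRel w x y) :
    fixOdd w ≤ fixOdd (refl x y) := by
  obtain ⟨β, -, h⟩ := h
  intro g hg
  refine mem_fixOdd_refl.2 ⟨fixOdd_le_one _ hg, ?_⟩
  have orthogonal : ∑ z, g z * root y x z = 0 := calc
    ∑ z, g z * root y x z = ∑ z, g (w.1 z) * root y x (w.1 z) :=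
      (Equiv.sum_comp w.1 fun z => g z * root y x z).symm
    _ = ∑ z, (g z * β z - g (w.1 z) * β (w.1 z)) :=
      Finset.sum_congr rfl fun z _ => by rw [← h, hg.2, mul_sub]
    _ = 0 := by
      rw [Finset.sum_sub_distrib, Equiv.sum_comp w.1 fun z => g z * β z, sub_self]
  rw [sum_mul_root hg.1] at orthogonal
  linarith

/-- If `w β + α = β` with `α = root y x`, then `w β` and `β` have the same norm, so the reflection
in `α` exchanges them. -/
theorem apply_refl_eq_add_root {w : hyperoctahedral n} {x y : SignedPt n} (hxy : x ≠ y)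
    {β : SignedPt n → ℚ} (hβ : ∀ z, β (bar z) = -β z)
    (h : ∀ z, β z - β (w.1 z) = root y x (w.1 z)) (z : SignedPt n) :
    β ((refl x y).1 z) = β z + root y x z := by
  have norm_eq : ∑ z, β z ^ 2 = ∑ z, (β z + root y x z) ^ 2 := calc
    ∑ z, β z ^ 2 = ∑ z, (β (w.1 z) + root y x (w.1 z)) ^ 2 :=
      Finset.sum_congr rfl fun z _ => by rw [← h, add_sub_cancel]
    _ = ∑ z, (β z + root y x z) ^ 2 := Equiv.sum_comp w.1 fun z => (β z + root y x z) ^ 2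
  simp only [add_sq, Finset.sum_add_distrib, mul_assoc, ← Finset.mul_sum, sum_mul_root hβ,
    sq (root y x _), sum_mul_root (root_bar y x)] at norm_eq
  have hα := root_left_sub_right_pos hxy.symm
  refine mul_left_cancel₀ hα.ne' ?_
  rw [refl_comm]
  linear_combination root_mul_apply_refl hβ y x z + root y x z * norm_eq / 2

theorem MovRel.fixDim_lt {w : hyperoctahedral n} {x y : SignedPt n} (h : MovRel w x y)
    (hxy : x ≠ y) : fixDim w < fixDim (refl x y * w) := by
  have hle := h.fixOdd_le
  obtain ⟨β, hβ, h⟩ := h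
  have mem : β ∈ fixOdd (refl x y * w) := by
    refine ⟨hβ, fun z => ?_⟩
    rw [mul_apply, apply_refl_eq_add_root hxy hβ h, ← h, add_sub_cancel]
  have notMem : β ∉ fixOdd w := fun hβw => by
    obtain ⟨z, rfl⟩ := w.1.surjective y
    have := root_left_pos hxy.symm
    rw [← h, hβw.2, sub_self] at this
    exact this.false
  exact Submodule.finrank_lt_finrank_of_lt <| SetLike.lt_iff_le_and_exists.2
    ⟨fun g hg => inf_fixOdd_le _ _ ⟨hle hg, hg⟩, β, mem, notMem⟩

open Classical in
/-- The difference of the indicator functions of the cycle of `a` and of its image under the bar. -/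
noncomputable def oddCycleIndicator (w : hyperoctahedral n) (a z : SignedPt n) : ℚ :=
  (if w.1.SameCycle a z then 1 else 0) - if w.1.SameCycle a (bar z) then 1 else 0

theorem oddCycleIndicator_mem_fixOdd (w : hyperoctahedral n) (a : SignedPt n) :
    oddCycleIndicator w a ∈ fixOdd w := by
  refine ⟨fun z => ?_, fun z => ?_⟩
  · simp only [oddCycleIndicator, bar_bar, neg_sub]
  · simp only [oddCycleIndicator, ← apply_bar, Equiv.Perm.sameCycle_apply_right]

theorem sameCycle_of_fixOdd_le {w : hyperoctahedral n} {x y : SignedPt n}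
    (h : fixOdd w ≤ fixOdd (refl x y)) (hx : ¬ w.1.SameCycle x (bar x)) :
    w.1.SameCycle x y := by
  have hxy := (mem_fixOdd_refl.1 (h (oddCycleIndicator_mem_fixOdd w x))).2
  by_contra hc
  simp only [oddCycleIndicator, hx, hc, Equiv.Perm.SameCycle.refl, if_true, if_false] at hxy
  split_ifs at hxy <;> norm_num at hxy

theorem sameCycle_or_balanced_of_fixOdd_le {w : hyperoctahedral n} {x y : SignedPt n}
    (h : fixOdd w ≤ fixOdd (refl x y)) : w.1.SameCycle x y ∨
      (w.1.SameCycle x (bar x) ∧ w.1.SameCycle y (bar y)) := by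
  by_cases hx : w.1.SameCycle x (bar x)
  · by_cases hy : w.1.SameCycle y (bar y)
    · exact Or.inr ⟨hx, hy⟩
    · exact Or.inl (sameCycle_of_fixOdd_le (refl_comm x y ▸ h) hy).symm
  · exact Or.inl (sameCycle_of_fixOdd_le h hx)

end FixedSpace

section ReflectionLength

theorem exists_fixDim_lt {w : hyperoctahedral n} (hw : w ≠ 1) :
    ∃ t ∈ reflections n, fixDim w < fixDim (t⁻¹ * w) := by
  obtain ⟨x, hx⟩ := exists_apply_ne hw
  refine ⟨_, refl_mem_reflections hx.symm, ?_⟩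
  rw [refl_inv]
  exact (movRel_apply w x).fixDim_lt hx.symm

theorem exists_codim_lt {w : hyperoctahedral n} (hw : w ≠ 1) :
    ∃ t ∈ reflections n, n - fixDim (t⁻¹ * w) < n - fixDim w := by
  obtain ⟨t, ht, hlt⟩ := exists_fixDim_lt hw
  exact ⟨t, ht, Nat.sub_lt_sub_left (hlt.trans_le (fixDim_le _)) hlt⟩

theorem closure_reflections : Submonoid.closure (reflections n) = ⊤ :=
  closure_eq_top_of_descent (d := fun w => n - fixDim w) fun _ => exists_codim_lt

theorem wordLength_reflections (w : hyperoctahedral n) :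
    wordLength (reflections n) w = n - fixDim w := by
  refine le_antisymm
    (wordLength_le_of_descent (d := fun w => n - fixDim w) (fun _ => exists_codim_lt) w)
    (le_wordLength closure_reflections (d := fun w => n - fixDim w) ?_ ?_ w)
  · simp [fixDim_one]
  · intro t ht w
    obtain ⟨x, y, -, rfl⟩ := exists_refl_of_mem ht
    have h₁ := le_fixDim_refl_add_one x y
    have h₂ := fixDim_add_le_mul (refl x y) w
    omega

theorem fixOdd_le_of_absLE {u v : hyperoctahedral n} (h : AbsLE (reflections n) u v) :
    fixOdd v ≤ fixOdd u := by
  simp only [AbsLE, wordLength_reflections] at h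
  have h₁ := fixDim_le u
  have h₂ := fixDim_le v
  have h₃ := fixDim_le (u⁻¹ * v)
  have h₄ := fixOdd_mul_eq_inf (u := u) (v := u⁻¹ * v) (by rw [mul_inv_cancel_left]; omega)
  rw [mul_inv_cancel_left] at h₄
  exact h₄ ▸ inf_le_left

theorem refl_absLE_of_sameCycle {w : hyperoctahedral n} {x y : SignedPt n} (hxy : x ≠ y)
    (h : w.1.SameCycle x y) : AbsLE (reflections n) (refl x y) w := by
  refine absLE_of_wordLength_lt closure_reflections (refl_mem_reflections hxy) ?_
  have h₁ := (movRel_of_sameCycle h).fixDim_lt hxy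
  have h₂ := fixDim_le (refl x y * w)
  rw [refl_inv, wordLength_reflections, wordLength_reflections]
  omega

end ReflectionLength

section Noncrossing

/-- A noncrossing partition of `±[n]` that is stable under the bar, encoded by the equivalence
relation that it induces on the integers by means of `SignedPt.ofInt`. -/
structure IsNC (n : ℕ) (E : Setoid ℤ) : Prop where
  shift : ∀ {x y : ℤ}, E x y → E (x + n) (y + n)
  period : ∀ x : ℤ, E x (x + 2 * n)
  noncross : ∀ {a b c d : ℤ}, a < b → b < c → c < d → d < a + 2 * n → E a c → E b d → E a b

/-- `z` is the first integer after `x` that is related to `x`. -/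
def IsNext (E : Setoid ℤ) (x z : ℤ) : Prop :=
  x < z ∧ E x z ∧ ∀ y, x < y → y < z → ¬ E x y

/-- `v` rotates each block of `E`. -/
def Rot [NeZero n] (E : Setoid ℤ) (v : hyperoctahedral n) : Prop :=
  ∀ x z, IsNext E x z → v.1 (ofInt x) = ofInt z

namespace IsNext

variable {E : Setoid ℤ} {x y z : ℤ}

theorem lt (h : IsNext E x z) : x < z := h.1

theorem rel (h : IsNext E x z) : E x z := h.2.1

theorem le (h : IsNext E x z) (hxy : x < y) (hE : E x y) : z ≤ y := by
  by_contra! hc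
  exact h.2.2 y hxy hc hE

theorem unique {z' : ℤ} (h : IsNext E x z) (h' : IsNext E x z') : z = z' :=
  (h.le h'.lt h'.rel).antisymm (h'.le h.lt h.rel)

end IsNext

theorem exists_isNext_of_lt {E : Setoid ℤ} {x y : ℤ} (hxy : x < y) (hE : E x y) :
    ∃ z, IsNext E x z ∧ z ≤ y := by
  obtain ⟨z, ⟨hz, hz'⟩, least⟩ := Int.exists_least_of_bdd (P := fun z => x < z ∧ E x z)
    ⟨x, fun z hz => hz.1.le⟩ ⟨y, hxy, hE⟩
  exact ⟨z, ⟨hz, hz', fun w hw hwz hc => (least w ⟨hw, hc⟩).not_gt hwz⟩, least y ⟨hxy, hE⟩⟩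

namespace IsNC

variable {E : Setoid ℤ} (hE : IsNC n E)
include hE

theorem add_two_mul_left_iff {x y : ℤ} : E (x + 2 * n) y ↔ E x y :=
  ⟨E.trans (hE.period x), E.trans (E.symm (hE.period x))⟩

theorem add_two_mul_right_iff {x y : ℤ} : E x (y + 2 * n) ↔ E x y :=
  ⟨fun h => E.trans h (E.symm (hE.period y)), fun h => E.trans h (hE.period y)⟩

theorem shift_iff {x y : ℤ} : E (x + n) (y + n) ↔ E x y := by
  refine ⟨fun h => ?_, hE.shift⟩
  have h' := hE.shift h
  rwa [add_assoc, add_assoc, ← two_mul, hE.add_two_mul_left_iff, hE.add_two_mul_right_iff] at h'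

theorem isNext_shift_iff {x z : ℤ} : IsNext E (x + n) (z + n) ↔ IsNext E x z := by
  refine and_congr (add_lt_add_iff_right _) (and_congr hE.shift_iff ⟨fun h y hy hy' => ?_, ?_⟩)
  · rw [← hE.shift_iff]
    exact h _ (by omega) (by omega)
  · intro h y hy hy'
    have := h (y - n) (by omega) (by omega)
    rwa [← hE.shift_iff, sub_add_cancel] at this

theorem isNext_add_two_mul_iff {x z : ℤ} :
    IsNext E (x + 2 * n) (z + 2 * n) ↔ IsNext E x z := by
  rw [two_mul, ← add_assoc, ← add_assoc, hE.isNext_shift_iff, hE.isNext_shift_iff]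

theorem le_or_lt_of_isNext {x z i j : ℤ} (hz : IsNext E x z) (h : E i j) (hxi : x < i)
    (hij : i < j) (hj : j ≤ x + 2 * n) : z ≤ i ∨ j < z := by
  by_contra! hc
  refine hz.2.2 i hxi hc.1 ?_
  rcases hc.2.eq_or_lt with rfl | hzj
  · exact E.trans hz.rel (E.symm h)
  rcases hj.eq_or_lt with rfl | hj
  · exact E.symm (hE.add_two_mul_right_iff.1 h)
  · exact hE.noncross hxi hc.1 hzj hj hz.rel h

variable [NeZero n]

theorem of_ofInt_eq {x y : ℤ} (h : (ofInt x : SignedPt n) = ofInt y) : E x y :=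
  Quotient.exact <| apply_eq_of_ofInt_eq (g := Quotient.mk E)
    (fun x => Quotient.sound (E.symm (hE.period x))) h

theorem rel_of_sameCycle {w : hyperoctahedral n} (hw : ∀ x y, w.1 (ofInt x) = ofInt y → E x y)
    {x y : ℤ} (h : w.1.SameCycle (ofInt x) (ofInt y)) : E x y := by
  obtain ⟨k, hk⟩ := h.exists_nat_pow_eq
  clear h
  induction k generalizing y with
  | zero => exact hE.of_ofInt_eq hk
  | succ k ih =>
    obtain ⟨z, hz⟩ := ofInt_surjective ((w.1 ^ k) (ofInt x))
    rw [pow_succ', Equiv.Perm.mul_apply, ← hz] at hk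
    exact E.trans (ih hz.symm) (hw _ _ hk)

theorem exists_isNext (x : ℤ) : ∃ z, IsNext E x z ∧ z ≤ x + 2 * n :=
  exists_isNext_of_lt (lt_add_of_pos_right x (two_mul_pos n)) (hE.period x)

theorem exists_rot : ∃ v : hyperoctahedral n, Rot E v := by
  choose f hf hf_le using hE.exists_isNext
  have add_self : ∀ x, f (x + n) = f x + n := fun x =>
    (hf (x + n)).unique (hE.isNext_shift_iff.2 (hf x))
  have f_lt : ∀ x y, x < y → E x y → f x < f y := fun x y hxy h =>
    ((hf x).le hxy h).trans_lt (hf y).lt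
  obtain ⟨v, hv⟩ := exists_forall_apply_ofInt add_self fun x y h => by
    obtain ⟨y', hy', hy'_lt, heq⟩ := exists_ofInt_window (f x - 2 * n) (ofInt y : SignedPt n)
    have h' : (ofInt (f y') : SignedPt n) = ofInt (f x) :=
      (apply_eq_of_ofInt_eq (periodic_ofInt_comp add_self) heq).trans h.symm
    have hfy' : f y' = f x := by
      have := (hf y').lt
      have := hf_le y'
      exact eq_of_ofInt_eq h' (by omega) (by omega)
    have hrel : E x y' := E.trans (hf x).rel (hfy' ▸ E.symm (hf y').rel)
    rcases lt_trichotomy x y' with hlt | rfl | hlt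
    · exact absurd hfy' (f_lt _ _ hlt hrel).ne'
    · exact heq
    · exact absurd hfy' (f_lt _ _ hlt (E.symm hrel)).ne
  exact ⟨v, fun x z hz => by rw [hv, hz.unique (hf x)]⟩

end IsNC

theorem isNC_top : IsNC n ⊤ where
  shift _ := trivial
  period _ := trivial
  noncross _ _ _ _ _ _ := trivial

variable [NeZero n]

namespace Rot

variable {E : Setoid ℤ} {v : hyperoctahedral n}

theorem rel (hv : Rot E v) (hE : IsNC n E) {x z : ℤ} (h : v.1 (ofInt x) = ofInt z) : E x z := by
  obtain ⟨y, hy, -⟩ := hE.exists_isNext x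
  exact E.trans hy.rel (hE.of_ofInt_eq ((hv x y hy).symm.trans h))

theorem sameCycle_of_rel (hv : Rot E v) {x y : ℤ} (h : E x y) :
    v.1.SameCycle (ofInt x) (ofInt y) := by
  wlog hxy : x ≤ y generalizing x y
  · exact (this (E.symm h) (le_of_not_ge hxy)).symm
  induction hm : (y - x).toNat using Nat.strong_induction_on generalizing x with
  | _ m ih =>
    rcases hxy.eq_or_lt with rfl | hlt
    · exact Equiv.Perm.SameCycle.refl _ _
    obtain ⟨z, hz, hzy⟩ := exists_isNext_of_lt hlt h
    have hxz := hz.lt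
    have hz' := ih (y - z).toNat (by omega) (E.trans (E.symm hz.rel) h) hzy rfl
    rwa [← hv x z hz, Equiv.Perm.sameCycle_apply_left] at hz'

theorem sameCycle_iff (hv : Rot E v) (hE : IsNC n E) {x y : ℤ} :
    v.1.SameCycle (ofInt x) (ofInt y) ↔ E x y :=
  ⟨hE.rel_of_sameCycle fun _ _ => hv.rel hE, hv.sameCycle_of_rel⟩

theorem apply_eq_self_iff (hv : Rot E v) (hE : IsNC n E) {x : ℤ} :
    v.1 (ofInt x) = ofInt x ↔ IsNext E x (x + 2 * n) := by
  refine ⟨fun h => ?_, fun h => by rw [hv _ _ h, ofInt_add_two_mul]⟩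
  obtain ⟨z, hz, hz_le⟩ := hE.exists_isNext x
  have hxz := hz.lt
  rw [hv x z hz, ← ofInt_add_two_mul x] at h
  rwa [eq_of_ofInt_eq h.symm (by omega) (by omega)]

end Rot

theorem rot_top : Rot ⊤ (coxeterElement n) := by
  intro x z hz
  have := hz.lt
  have := hz.le (lt_add_one x) trivial
  rw [coxeterElement_ofInt, show z = x + 1 by omega]

end Noncrossing

section Cut

/-- The integers in `(i, j]` modulo `2n`. -/
def arc (n : ℕ) (i j x : ℤ) : Prop := ∃ k : ℤ, i + 2 * n * k < x ∧ x ≤ j + 2 * n * k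

/-- Cut the blocks of `E` along the chord from `i` to `j` and along its opposite. -/
def cut (n : ℕ) (i j : ℤ) (E : Setoid ℤ) : Setoid ℤ :=
  E ⊓ Setoid.ker fun x => (arc n i j x, arc n i j (x + n))

theorem cut_iff {i j x y : ℤ} {E : Setoid ℤ} : cut n i j E x y ↔
    E x y ∧ (arc n i j x ↔ arc n i j y) ∧ (arc n i j (x + n) ↔ arc n i j (y + n)) := by
  rw [cut, Setoid.inf_iff_and, Setoid.ker_def, Prod.mk.injEq, eq_iff_iff, eq_iff_iff]

theorem cut_mono {E E' : Setoid ℤ} (h : E ≤ E') (i j : ℤ) : cut n i j E ≤ cut n i j E' :=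
  inf_le_inf_right _ h

theorem arc_add_mul {i j x : ℤ} (k : ℤ) : arc n i j (x + 2 * n * k) ↔ arc n i j x :=
  ⟨fun ⟨l, h₁, h₂⟩ => ⟨l - k, by linarith, by linarith⟩,
    fun ⟨l, h₁, h₂⟩ => ⟨l + k, by linarith, by linarith⟩⟩

theorem arc_add_two_mul {i j x : ℤ} : arc n i j (x + 2 * n) ↔ arc n i j x := by
  simpa using arc_add_mul (n := n) 1

theorem arc_iff {i j x : ℤ} (k : ℤ) (hj : j ≤ i + 2 * n) (h₁ : i + 2 * n * k < x)
    (h₂ : x ≤ i + 2 * n * k + 2 * n) : arc n i j x ↔ x ≤ j + 2 * n * k := by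
  refine ⟨?_, fun h => ⟨k, h₁, h⟩⟩
  rintro ⟨l, hl, hl'⟩
  have : l = k := le_antisymm (by nlinarith) (by nlinarith)
  exact this ▸ hl'

theorem arc_iff_two_turns {i j x : ℤ} (hj : j ≤ i + 2 * n) (h₁ : i < x) (h₂ : x ≤ i + 4 * n) :
    arc n i j x ↔ x ≤ j ∨ (i + 2 * n < x ∧ x ≤ j + 2 * n) := by
  by_cases h : x ≤ i + 2 * n
  · rw [arc_iff 0 hj (by omega) (by omega)]
    omega
  · rw [arc_iff 1 hj (by omega) (by omega)]
    omega

theorem cut_iff_two_turns {i j x y : ℤ} {E : Setoid ℤ} (hj : j ≤ i + 2 * n) (hx : i < x)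
    (hx' : x ≤ i + 3 * n) (hy : i < y) (hy' : y ≤ i + 3 * n) : cut n i j E x y ↔ E x y ∧
      (x ≤ j ∨ (i + 2 * n < x ∧ x ≤ j + 2 * n) ↔ y ≤ j ∨ (i + 2 * n < y ∧ y ≤ j + 2 * n)) ∧
      (x + n ≤ j ∨ (i + n < x ∧ x ≤ j + n) ↔ y + n ≤ j ∨ (i + n < y ∧ y ≤ j + n)) := by
  rw [cut_iff, arc_iff_two_turns hj hx (by omega), arc_iff_two_turns hj hy (by omega),
    arc_iff_two_turns hj (by omega) (by omega), arc_iff_two_turns hj (by omega) (by omega)]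
  refine and_congr Iff.rfl (and_congr Iff.rfl ?_)
  omega

theorem arc_noncross [NeZero n] {i j : ℤ} (hj : j ≤ i + 2 * n) {a b c d : ℤ}
    (hab : a < b) (hbc : b < c) (hcd : c < d) (hda : d < a + 2 * n)
    (hac : arc n i j a ↔ arc n i j c) (hbd : arc n i j b ↔ arc n i j d) :
    arc n i j a ↔ arc n i j b := by
  obtain ⟨k, hk, hk'⟩ : ∃ k : ℤ, i < a + 2 * n * k ∧ a + 2 * n * k ≤ i + 2 * n := by
    obtain ⟨x, h₁, h₂, h₃⟩ := exists_ofInt_window (n := n) (i + 1) (ofInt a)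
    obtain ⟨k, rfl⟩ := ofInt_eq_iff.1 h₃.symm
    exact ⟨k, by omega, by omega⟩
  rw [← arc_add_mul k, ← arc_add_mul (x := c) k] at hac
  rw [← arc_add_mul k, ← arc_add_mul (x := d) k] at hbd
  rw [← arc_add_mul k, ← arc_add_mul (x := b) k]
  generalize 2 * (n : ℤ) * k = m at *
  rw [arc_iff_two_turns hj (by omega) (by omega), arc_iff_two_turns hj (by omega) (by omega)]
    at hac hbd ⊢
  omega

theorem isNC_cut [NeZero n] {E : Setoid ℤ} (hE : IsNC n E) {i j : ℤ} (hj : j ≤ i + 2 * n) :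
    IsNC n (cut n i j E) where
  shift {x y} h := by
    obtain ⟨h, h₁, h₂⟩ := cut_iff.1 h
    refine cut_iff.2 ⟨hE.shift h, h₂, ?_⟩
    rwa [add_assoc, add_assoc, ← two_mul, arc_add_two_mul, arc_add_two_mul]
  period x := cut_iff.2 ⟨hE.period x, arc_add_two_mul.symm, by
    rw [add_right_comm, arc_add_two_mul]⟩
  noncross hab hbc hcd hda hac hbd := by
    obtain ⟨hac, hac₁, hac₂⟩ := cut_iff.1 hac
    obtain ⟨hbd, hbd₁, hbd₂⟩ := cut_iff.1 hbd
    exact cut_iff.2 ⟨hE.noncross hab hbc hcd hda hac hbd,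
      arc_noncross hj hab hbc hcd hda hac₁ hbd₁,
      arc_noncross hj (by omega) (by omega) (by omega) (by omega) hac₂ hbd₂⟩

end Cut

section RotCut

variable {E : Setoid ℤ} {i j x z : ℤ}

theorem IsNC.isNext_cut_of_ne (hE : IsNC n E) (hj : j ≤ i + n) (h : E i j) (hix : i < x)
    (hxi : x < i + n) (hxj : x ≠ j) (hz : IsNext E x z) : IsNext (cut n i j E) x z := by
  have hxz := hz.lt
  have hz_le : z ≤ x + 2 * n := hz.le (by omega) (hE.period x)
  have h₁ : x < j → z ≤ j ∨ i + 2 * n < z := fun hlt =>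
    hE.le_or_lt_of_isNext hz (hE.add_two_mul_right_iff.2 (E.symm h)) hlt (by omega) (by omega)
  have h₂ : z ≤ i + n ∨ j + n < z := by
    by_cases hij : i < j
    · exact hE.le_or_lt_of_isNext hz (hE.shift h) hxi (by omega) (by omega)
    · omega
  have h₃ : j < x → z ≤ i + 2 * n ∨ j + 2 * n < z := fun hlt => by
    by_cases hij : i < j
    · exact hE.le_or_lt_of_isNext hz (hE.add_two_mul_left_iff.2 (hE.add_two_mul_right_iff.2 h))
        (by omega) (by omega) (by omega)
    · omega
  refine ⟨hxz, ?_, fun y hxy hyz hc => hz.2.2 y hxy hyz (cut_iff.1 hc).1⟩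
  rw [cut_iff_two_turns (by omega) hix (by omega) (by omega) (by omega)]
  refine ⟨hz.rel, ?_⟩
  omega

theorem IsNC.isNext_cut_shift_left (hE : IsNC n E) (hij : i < j) (hj : j ≤ i + n) (h : E i j)
    (hz : IsNext E (j + n) z) : IsNext (cut n i j E) (i + n) z := by
  have hxz := hz.lt
  have hz_le : z ≤ i + n + 2 * n :=
    hz.le (by omega) (hE.add_two_mul_right_iff.2 (E.symm (hE.shift h)))
  have h₁ : j < i + n → z ≤ i + 2 * n ∨ j + 2 * n < z := fun hlt =>
    hE.le_or_lt_of_isNext hz (hE.add_two_mul_left_iff.2 (hE.add_two_mul_right_iff.2 h))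
      (by omega) (by omega) (by omega)
  refine ⟨by omega, ?_, fun y hy hyz hc => ?_⟩
  · rw [cut_iff_two_turns (by omega) (by omega) (by omega) (by omega) (by omega)]
    refine ⟨E.trans (hE.shift h) hz.rel, ?_⟩
    omega
  · rw [cut_iff_two_turns (by omega) (by omega) (by omega) (by omega) (by omega)] at hc
    exact hz.2.2 y (by omega) hyz (E.trans (E.symm (hE.shift h)) hc.1)

theorem IsNC.isNext_cut_right (hE : IsNC n E) (hij : i < j) (hj : j ≤ i + n) (h : E i j)
    (hz : IsNext E i z) : IsNext (cut n i j E) j (z + 2 * n) := by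
  have hiz := hz.lt
  have hz_le : z ≤ j := hz.le hij h
  refine ⟨by omega, ?_, fun y hy hyz hc => ?_⟩
  · rw [cut_iff_two_turns (by omega) (by omega) (by omega) (by omega) (by omega)]
    refine ⟨hE.add_two_mul_right_iff.2 (E.trans (E.symm h) hz.rel), ?_⟩
    omega
  · rw [cut_iff_two_turns (by omega) (by omega) (by omega) (by omega) (by omega)] at hc
    refine hz.2.2 (y - 2 * n) (by omega) (by omega) ?_
    rw [← hE.add_two_mul_right_iff, sub_add_cancel]
    exact E.trans h hc.1

variable [NeZero n] {v : hyperoctahedral n}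

theorem forall_of_forall_half {P : ℤ → Prop} (hP : ∀ x, P (x + n) ↔ P x) (i : ℤ)
    (h : ∀ x, i < x → x ≤ i + n → P x) (x : ℤ) : P x := by
  obtain ⟨y, hy, heq⟩ := Function.Periodic.exists_mem_Ioc (f := P) (fun x => propext (hP x))
    (Nat.cast_pos.2 (NeZero.pos n)) x i
  exact heq ▸ h y hy.1 hy.2

theorem rot_of_half (hE : IsNC n E) (i : ℤ) (h : ∀ x, i < x → x ≤ i + n →
    ∃ z, IsNext E x z ∧ v.1 (ofInt x) = ofInt z) : Rot E v := by
  refine forall_of_forall_half (n := n) (P := fun x => ∀ z, IsNext E x z → v.1 (ofInt x) = ofInt z)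
    (fun x => ?_) i fun x hix hxi z hz => ?_
  · rw [← (Equiv.addRight (n : ℤ)).forall_congr_right]
    simp only [Equiv.coe_addRight, hE.isNext_shift_iff, ofInt_add_self, apply_bar,
      bar_eq_iff, bar_bar]
  · obtain ⟨z', hz', hv⟩ := h x hix hxi
    rw [hv, hz'.unique hz]

theorem refl_ofInt_of_ne (hij : i < j) (hj : j ≤ i + n) (hix : i < x) (hxi : x < i + n)
    (hxj : x ≠ j) : (refl (ofInt i) (ofInt j)).1 (ofInt x) = (ofInt x : SignedPt n) := by
  refine refl_of_ne (fun hc => ?_) (fun hc => ?_) (fun hc => ?_) (fun hc => ?_)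
  · have := eq_of_ofInt_eq hc (by omega) (by omega)
    omega
  · have := eq_of_ofInt_eq hc (by omega) (by omega)
    omega
  · rw [← ofInt_add_self] at hc
    have := eq_of_ofInt_eq hc (by omega) (by omega)
    omega
  · rw [← ofInt_add_self] at hc
    have := eq_of_ofInt_eq hc (by omega) (by omega)
    omega

theorem Rot.mul_refl (hv : Rot E v) (hE : IsNC n E) (hij : i < j) (hj : j ≤ i + n) (h : E i j) :
    Rot (cut n i j E) (v * refl (ofInt i) (ofInt j)) := by
  refine rot_of_half (isNC_cut hE (by omega)) i fun x hix hxi => ?_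
  rw [mul_apply]
  rcases hxi.eq_or_lt with rfl | hxi
  · obtain ⟨z, hz, -⟩ := hE.exists_isNext (j + n)
    refine ⟨z, hE.isNext_cut_shift_left hij hj h hz, ?_⟩
    rw [ofInt_add_self, apply_bar, refl_left, ← ofInt_add_self]
    exact hv _ _ hz
  rcases eq_or_ne x j with rfl | hxj
  · obtain ⟨z, hz, -⟩ := hE.exists_isNext i
    refine ⟨z + 2 * n, hE.isNext_cut_right hij hj h hz, ?_⟩
    rw [refl_right, ofInt_add_two_mul]
    exact hv _ _ hz
  · obtain ⟨z, hz, -⟩ := hE.exists_isNext x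
    refine ⟨z, hE.isNext_cut_of_ne hj h hix hxi hxj hz, ?_⟩
    rw [refl_ofInt_of_ne hij hj hix hxi hxj]
    exact hv _ _ hz

end RotCut

section Projection

variable [NeZero n] {E : Setoid ℤ} {u v w : hyperoctahedral n}

theorem IsNC.rel_of_balanced (hE : IsNC n E) {a b : ℤ} (ha : E a (a + n)) (hb : E b (b + n)) :
    E a b := by
  obtain ⟨c, hac, hca, hc⟩ := exists_ofInt_window (n := n) (a + 1) (ofInt b)
  have hcb : E c b := hE.of_ofInt_eq hc
  have hcc : E c (c + n) := E.trans hcb (E.trans hb (E.symm (hE.shift hcb)))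
  have ha' : E (a + n) (a + 2 * n) := hE.add_two_mul_right_iff.2 (E.symm ha)
  refine E.trans ?_ hcb
  rcases lt_trichotomy c (a + n) with h | rfl | h
  · exact hE.noncross (by omega) h (by omega) (by omega) ha hcc
  · exact ha
  · rcases (show c ≤ a + 2 * n by omega).eq_or_lt with rfl | h'
    · exact hE.period a
    · exact E.trans ha (hE.noncross h h' (by omega) (by omega) ha' hcc)

theorem Rot.rel_of_fixOdd_le (hv : Rot E v) (hE : IsNC n E) {a b : ℤ}
    (h : fixOdd v ≤ fixOdd (refl (ofInt a) (ofInt b))) : E a b := by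
  rcases sameCycle_or_balanced_of_fixOdd_le h with h | ⟨ha, hb⟩
  · exact (hv.sameCycle_iff hE).1 h
  · rw [← ofInt_add_self, hv.sameCycle_iff hE] at ha hb
    exact hE.rel_of_balanced ha hb

theorem IsNC.exists_short_chord (hE : IsNC n E) {a b : ℤ}
    (hab : (ofInt a : SignedPt n) ≠ ofInt b) (h : E a b) : ∃ i j : ℤ, i < j ∧ j ≤ i + n ∧ E i j ∧
      refl (ofInt a) (ofInt b) = (refl (ofInt i) (ofInt j) : hyperoctahedral n) := by
  obtain ⟨j, haj, hja, hj⟩ := exists_ofInt_window (n := n) a (ofInt b)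
  have hne : a ≠ j := fun he => hab (by rw [he, hj])
  have hEj : E a j := E.trans h (hE.of_ofInt_eq hj.symm)
  by_cases hle : j ≤ a + n
  · exact ⟨a, j, by omega, hle, hEj, by rw [hj]⟩
  · refine ⟨j, a + 2 * n, by omega, by omega, hE.add_two_mul_right_iff.2 (E.symm hEj), ?_⟩
    rw [hj, ofInt_add_two_mul, refl_comm]

theorem absLE_of_le {P Q : Setoid ℤ} (hP : IsNC n P) (hQ : IsNC n Q) (hPQ : P ≤ Q)
    (hu : Rot P u) (hv : Rot Q v) : AbsLE (reflections n) u v := by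
  induction hm : wordLength (reflections n) u using Nat.strong_induction_on
    generalizing P Q u v with
  | _ m ih =>
    by_cases hu1 : u = 1
    · exact hu1 ▸ one_absLE v
    obtain ⟨x, hx⟩ := exists_apply_ne hu1
    obtain ⟨a, rfl⟩ := ofInt_surjective x
    obtain ⟨b, hb⟩ := ofInt_surjective (u.1 (ofInt a))
    rw [← hb] at hx
    obtain ⟨i, j, hij, hji, hPij, -⟩ := hP.exists_short_chord hx.symm (hu.rel hP hb.symm)
    have hne : (ofInt i : SignedPt n) ≠ ofInt j := fun h => by
      have := eq_of_ofInt_eq h (by omega) (by omega)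
      omega
    set t : hyperoctahedral n := refl (ofInt i) (ofInt j) with ht
    have htu : AbsLE (reflections n) t u :=
      refl_absLE_of_sameCycle hne (hu.sameCycle_of_rel hPij)
    have htv : AbsLE (reflections n) t v :=
      refl_absLE_of_sameCycle hne (hv.sameCycle_of_rel (hPQ hPij))
    have ht_pos : wordLength (reflections n) t ≠ 0 := fun h0 => hne <| by
      rw [← refl_left (ofInt i : SignedPt n) (ofInt j), ← ht,
        eq_one_of_wordLength_eq_zero closure_reflections h0]
      rfl
    have hlen := htu.wordLength_eq closure_reflections conj_mem_reflections
    refine AbsLE.of_mul_inv closure_reflections conj_mem_reflections htu htv ?_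
    refine ih _ (by omega) (isNC_cut hP (by omega)) (isNC_cut hQ (by omega)) (cut_mono hPQ i j)
      ?_ ?_ rfl
    · rw [ht, refl_inv]
      exact hu.mul_refl hP hij hji hPij
    · rw [ht, refl_inv]
      exact hv.mul_refl hQ hij hji (hPQ hPij)

theorem exists_isNC_of_absLE (h : AbsLE (reflections n) u (coxeterElement n)) :
    ∃ P, IsNC n P ∧ Rot P u := by
  refine h.induction closure_reflections conj_mem_reflections
    (p := fun u => ∃ P, IsNC n P ∧ Rot P u) ⟨⊤, isNC_top, rot_top⟩ ?_
  rintro w t ht htw ⟨P, hP, hrot⟩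
  obtain ⟨x, y, hxy, rfl⟩ := exists_refl_of_mem ht
  obtain ⟨a, rfl⟩ := ofInt_surjective x
  obtain ⟨b, rfl⟩ := ofInt_surjective y
  obtain ⟨i, j, hij, hji, hPij, heq⟩ :=
    hP.exists_short_chord hxy (hrot.rel_of_fixOdd_le hP (fixOdd_le_of_absLE htw))
  rw [refl_inv, heq]
  exact ⟨_, isNC_cut hP (by omega), hrot.mul_refl hP hij hji hPij⟩

/-- The finest noncrossing partition that is coarser than the cycle partition of `w`. -/
def ncClosure (w : hyperoctahedral n) : Setoid ℤ :=
  sInf {P | IsNC n P ∧ ∀ a b, w.1 (ofInt a) = ofInt b → P a b}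

theorem isNC_ncClosure (w : hyperoctahedral n) : IsNC n (ncClosure w) where
  shift h P hP := hP.1.shift (h P hP)
  period x _ hP := hP.1.period x
  noncross hab hbc hcd hda h h' P hP := hP.1.noncross hab hbc hcd hda (h P hP) (h' P hP)

theorem ncClosure_of_apply {a b : ℤ} (h : w.1 (ofInt a) = ofInt b) : ncClosure w a b :=
  fun _ hP => hP.2 a b h

theorem ncClosure_le (hE : IsNC n E) (hw : ∀ a b, w.1 (ofInt a) = ofInt b → E a b) :
    ncClosure w ≤ E :=
  sInf_le ⟨hE, hw⟩

theorem ncClosure_of_fixOdd_le {a b : ℤ} (h : fixOdd w ≤ fixOdd (refl (ofInt a) (ofInt b))) :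
    ncClosure w a b := by
  have hE := isNC_ncClosure w
  have rel {x y : ℤ} (h : w.1.SameCycle (ofInt x) (ofInt y)) : ncClosure w x y :=
    hE.rel_of_sameCycle (fun _ _ => ncClosure_of_apply) h
  rcases sameCycle_or_balanced_of_fixOdd_le h with h | ⟨ha, hb⟩
  · exact rel h
  · rw [← ofInt_add_self] at ha hb
    exact hE.rel_of_balanced (rel ha) (rel hb)

theorem isNoncrossingJoin_of_rot (hv : Rot (ncClosure w) v) :
    IsNoncrossingJoin (reflections n) (coxeterElement n) w v := by
  have hE := isNC_ncClosure w
  refine ⟨⟨one_absLE v, absLE_of_le hE isNC_top le_top hv rot_top⟩, ?_, ?_⟩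
  · intro t ht htw
    obtain ⟨x, y, hxy, rfl⟩ := exists_refl_of_mem ht
    obtain ⟨a, rfl⟩ := ofInt_surjective x
    obtain ⟨b, rfl⟩ := ofInt_surjective y
    exact refl_absLE_of_sameCycle hxy
      (hv.sameCycle_of_rel (ncClosure_of_fixOdd_le (fixOdd_le_of_absLE htw)))
  · intro u hu hle
    obtain ⟨P, hP, hrot⟩ := exists_isNC_of_absLE hu.2
    refine absLE_of_le hE hP (ncClosure_le hP fun a b hab => ?_) hv hrot
    by_cases hne : (ofInt a : SignedPt n) = ofInt b
    · exact hP.of_ofInt_eq hne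
    refine hrot.rel_of_fixOdd_le hP (fixOdd_le_of_absLE (hle _ (refl_mem_reflections hne) ?_))
    refine refl_absLE_of_sameCycle hne ?_
    rw [← hab]
    exact Equiv.Perm.sameCycle_apply_right.2 (Equiv.Perm.SameCycle.refl _ _)

theorem rot_piT (w : hyperoctahedral n) : Rot (ncClosure w) (piT w) := by
  obtain ⟨v, hv⟩ := (isNC_ncClosure w).exists_rot
  have hjoin := isNoncrossingJoin_of_rot hv
  have hex : ∃ v, IsNoncrossingJoin (reflections n) (coxeterElement n) w v := ⟨v, hjoin⟩
  have hpi : IsNoncrossingJoin (reflections n) (coxeterElement n) w (piT w) := by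
    rw [show piT w = hex.choose from dif_pos hex]
    exact hex.choose_spec
  rwa [(hpi.2.2 v hjoin.1 hjoin.2.1).antisymm closure_reflections (hjoin.2.2 _ hpi.1 hpi.2.1)]

open Classical in
/-- The partition of `±[n]` whose only nontrivial block is the set `S`. -/
noncomputable def blockSetoid (n : ℕ) [NeZero n] (S : ℤ → Prop) : Setoid ℤ :=
  Setoid.ker fun x => if S x then none else some (ofInt x : SignedPt n)

theorem blockSetoid_iff {S : ℤ → Prop} {x y : ℤ} : blockSetoid n S x y ↔
    S x ∧ S y ∨ ¬ S x ∧ ¬ S y ∧ (ofInt x : SignedPt n) = ofInt y := by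
  rw [blockSetoid, Setoid.ker_def]
  split_ifs <;> simp [*]

theorem isNC_blockSetoid {S : ℤ → Prop} (hS : ∀ x, S (x + n) ↔ S x) :
    IsNC n (blockSetoid n S) where
  shift {x y} h := by
    rw [blockSetoid_iff] at h ⊢
    rw [hS, hS, ofInt_add_self, ofInt_add_self]
    exact h.imp_right fun ⟨hx, hy, heq⟩ => ⟨hx, hy, congrArg bar heq⟩
  period x := by
    rw [blockSetoid_iff, ofInt_add_two_mul, two_mul, ← add_assoc, hS, hS]
    tauto
  noncross hab hbc hcd hda hac hbd := by
    rw [blockSetoid_iff] at hac hbd ⊢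
    rcases hac with hac | ⟨-, -, hac⟩
    · rcases hbd with hbd | ⟨-, -, hbd⟩
      · exact Or.inl ⟨hac.1, hbd.1⟩
      · exact absurd (eq_of_ofInt_eq hbd (by omega) (by omega)) (by omega)
    · exact absurd (eq_of_ofInt_eq hac (by omega) (by omega)) (by omega)

theorem ofInt_eq_of_ncClosure {x y : ℤ} (hx : w.1 (ofInt x) = ofInt x)
    (h : ncClosure w x y) : (ofInt x : SignedPt n) = ofInt y := by
  have moved_add_self (a : ℤ) :
      w.1 (ofInt (a + n)) ≠ ofInt (a + n) ↔ w.1 (ofInt a) ≠ ofInt a := by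
    rw [ofInt_add_self, apply_bar, ne_eq, bar_eq_iff, bar_bar]
  have orbit_le (a b : ℤ) (hab : w.1 (ofInt a) = ofInt b) :
      blockSetoid n (fun a => w.1 (ofInt a) ≠ ofInt a) a b := by
    rw [blockSetoid_iff]
    by_cases ha : w.1 (ofInt a) = ofInt a
    · have heq : (ofInt a : SignedPt n) = ofInt b := ha.symm.trans hab
      exact Or.inr ⟨not_not.2 ha, not_not.2 (heq ▸ ha), heq⟩
    · exact Or.inl ⟨ha, fun hb => ha (by rw [hab, w.1.injective (hab.trans hb.symm)])⟩
  rcases blockSetoid_iff.1 (ncClosure_le (isNC_blockSetoid moved_add_self) orbit_le h)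
    with h' | h'
  · exact absurd hx h'.1
  · exact h'.2.2

theorem piT_apply_eq_self_iff {p : SignedPt n} : (piT w).1 p = p ↔ w.1 p = p := by
  have hE := isNC_ncClosure w
  obtain ⟨x, rfl⟩ := ofInt_surjective p
  constructor
  · intro h
    obtain ⟨y, hxy, hyx, hy⟩ := exists_ofInt_window (n := n) (x + 1) (w.1 (ofInt x))
    have := (((rot_piT w).apply_eq_self_iff hE).1 h).le (by omega) (ncClosure_of_apply hy.symm)
    rw [← hy, show y = x + 2 * n by omega, ofInt_add_two_mul]
  · intro h
    obtain ⟨y, hy⟩ := ofInt_surjective ((piT w).1 (ofInt x))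
    rw [← hy, ← ofInt_eq_of_ncClosure h ((rot_piT w).rel hE hy.symm)]

end Projection

end Hyperoctahedral

section ForwardOrbit

variable {X : Type*} {f : X → X} {m : X → ℕ} {x : X}

theorem forwardOrbit_eq_insert (f : X → X) (x : X) :
    forwardOrbit f x = insert x (forwardOrbit f (f x)) := by
  ext y
  simp only [forwardOrbit, Set.mem_range, Set.mem_insert_iff]
  constructor
  · rintro ⟨_ | k, rfl⟩
    · exact Or.inl rfl
    · exact Or.inr ⟨k, rfl⟩
  · rintro (rfl | ⟨k, rfl⟩)
    · exact ⟨0, rfl⟩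
    · exact ⟨k + 1, rfl⟩

theorem forwardOrbit_of_isFixedPt (h : Function.IsFixedPt f x) : forwardOrbit f x = {x} := by
  simp only [forwardOrbit, Function.iterate_fixed h, Set.range_const]

variable (hm : ∀ x, f x ≠ x → m (f x) < m x)

include hm

theorem le_of_mem_forwardOrbit {y : X} (hy : y ∈ forwardOrbit f x) : m y ≤ m x := by
  obtain ⟨k, rfl⟩ := hy
  induction k with
  | zero => exact le_rfl
  | succ k ih =>
    simp only [Function.iterate_succ_apply'] at ih ⊢
    by_cases h : f (f^[k] x) = f^[k] x
    · rwa [h]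
    · exact (hm _ h).le.trans ih

theorem finite_forwardOrbit_and_ncard_le (x : X) :
    (forwardOrbit f x).Finite ∧ (forwardOrbit f x).ncard ≤ m x + 1 := by
  induction hk : m x using Nat.strong_induction_on generalizing x with
  | _ k ih =>
    by_cases h : f x = x
    · rw [forwardOrbit_of_isFixedPt h, Set.ncard_singleton]
      exact ⟨Set.finite_singleton x, by omega⟩
    · have hlt := hm x h
      obtain ⟨fin, le⟩ := ih _ (by omega) (f x) rfl
      rw [forwardOrbit_eq_insert]
      exact ⟨fin.insert x, (Set.ncard_insert_le _ _).trans (by omega)⟩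

theorem ncard_forwardOrbit_le (x : X) : (forwardOrbit f x).ncard ≤ m x + 1 :=
  (finite_forwardOrbit_and_ncard_le hm x).2

theorem ncard_forwardOrbit_of_apply_ne (h : f x ≠ x) :
    (forwardOrbit f x).ncard = (forwardOrbit f (f x)).ncard + 1 := by
  rw [forwardOrbit_eq_insert, Set.ncard_insert_of_notMem
    (fun hx => (hm x h).not_ge (le_of_mem_forwardOrbit hm hx))
    (finite_forwardOrbit_and_ncard_le hm (f x)).1]

end ForwardOrbit

namespace Hyperoctahedral

open SignedPt

variable {n : ℕ}

section Descents

variable [NeZero n] {E : Setoid ℤ} {v : hyperoctahedral n} {p q : SignedPt n}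

theorem Rot.lt_and_le_of_lt (hv : Rot E v) (hE : IsNC n E) (h : v.1.SameCycle p q)
    (hpq : p < q) : p < v.1 p ∧ v.1 p ≤ q := by
  obtain ⟨x, hx, hx', rfl⟩ := exists_ofInt_window (n := n) 0 p
  obtain ⟨y, hy, hy', rfl⟩ := exists_ofInt_window (n := n) 0 q
  rw [zero_add] at hx' hy'
  rw [ofInt_lt_iff hx hx' hy hy'] at hpq
  obtain ⟨z, hz, hzy⟩ := exists_isNext_of_lt hpq ((hv.sameCycle_iff hE).1 h)
  have := hz.lt
  rw [hv x z hz, ofInt_lt_iff hx hx' (by omega) (by omega), ← not_lt,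
    ofInt_lt_iff hy hy' (by omega) (by omega)]
  omega

theorem Rot.apply_le_of_isMax (hv : Rot E v) (hE : IsNC n E)
    (hp : ∀ q, v.1.SameCycle p q → q ≤ p) (h : v.1.SameCycle p q) : v.1 p ≤ q := by
  obtain ⟨x, hx, hx', rfl⟩ := exists_ofInt_window (n := n) 0 p
  obtain ⟨y, hy, hy', rfl⟩ := exists_ofInt_window (n := n) 0 q
  rw [zero_add] at hx' hy'
  obtain ⟨z, hz, -⟩ := hE.exists_isNext x
  have hxz := hz.lt
  have wraps : 2 * n ≤ z := by
    by_contra! hc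
    have h₃ := hp (ofInt z) ((hv.sameCycle_iff hE).2 hz.rel)
    rw [← not_lt, ofInt_lt_iff hx hx' (by omega) (by omega)] at h₃
    omega
  have hzy : z ≤ y + 2 * n :=
    hz.le (by omega) (hE.add_two_mul_right_iff.2 ((hv.sameCycle_iff hE).1 h))
  rw [hv x z hz, ← sub_add_cancel z (2 * n), ofInt_add_two_mul, ← not_lt,
    ofInt_lt_iff hy hy' (by omega) (by omega)]
  omega

theorem Rot.le_of_apply_le (hv : Rot E v) (hE : IsNC n E) (hp : v.1 p ≤ p)
    (h : v.1.SameCycle p q) : q ≤ p :=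
  le_of_not_gt fun hc => (hv.lt_and_le_of_lt hE h hc).1.not_ge hp

theorem Rot.exists_sameCycle_apply_lt (hv : Rot E v) (hE : IsNC n E) (hp : v.1 p ≠ p) :
    ∃ q, v.1.SameCycle p q ∧ v.1 q < q := by
  classical
  obtain ⟨q, hq, le_q⟩ := (Finset.univ.filter (v.1.SameCycle p)).exists_max_image id
    ⟨p, Finset.mem_filter.2 ⟨Finset.mem_univ p, .refl _ _⟩⟩
  rw [Finset.mem_filter] at hq
  have isMax (q' : SignedPt n) (h : v.1.SameCycle q q') : q' ≤ q :=
    le_q q' (Finset.mem_filter.2 ⟨Finset.mem_univ q', hq.2.trans h⟩)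
  exact ⟨q, hq.2, (hv.apply_le_of_isMax hE isMax (.refl _ _)).lt_of_ne
    fun h => hp (hq.2.apply_eq_self_iff.2 h)⟩

/-- The unique descent in a nontrivial cycle is at its maximum. -/
theorem Rot.card_descents (hv : Rot E v) (hE : IsNC n E) :
    (Finset.univ.filter fun y : SignedPt n => v.1 y < y).card = cyc v := by
  have mem_support {y : SignedPt n} (hy : v.1 y < y) : y ∈ v.1.support :=
    Equiv.Perm.mem_support.2 hy.ne
  refine Finset.card_bij (fun y _ => v.1.cycleOf y) (fun y hy => ?_) (fun y hy y' hy' h => ?_)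
    fun σ hσ => ?_
  · exact Equiv.Perm.cycleOf_mem_cycleFactorsFinset_iff.2
      (mem_support (Finset.mem_filter.1 hy).2)
  · have hy := (Finset.mem_filter.1 hy).2
    have hy' := (Finset.mem_filter.1 hy').2
    have same : v.1.SameCycle y y' := (Equiv.Perm.sameCycle_iff_cycleOf_eq_of_mem_support
      (mem_support hy) (mem_support hy')).2 h
    exact (hv.le_of_apply_le hE hy'.le same.symm).antisymm (hv.le_of_apply_le hE hy.le same)
  · obtain ⟨p, hp, -⟩ := (Equiv.Perm.mem_cycleFactorsFinset_iff.1 hσ).1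
    have hp := Equiv.Perm.mem_support.2 hp
    obtain ⟨q, hpq, hq⟩ := hv.exists_sameCycle_apply_lt hE
      (Equiv.Perm.mem_support.1 (Equiv.Perm.mem_cycleFactorsFinset_support_le hσ hp))
    exact ⟨q, Finset.mem_filter.2 ⟨Finset.mem_univ q, hq⟩,
      hpq.symm.cycleOf_eq.trans (Equiv.Perm.cycle_is_cycleOf hp hσ).symm⟩

end Descents

section Pop

theorem pop_inv_apply (w : hyperoctahedral n) (p : SignedPt n) :
    ((pop w)⁻¹).1 p = (piT w).1 ((w⁻¹).1 p) := rfl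

theorem aexc_one : aexc (1 : hyperoctahedral n) = 0 := by
  simp [aexc]

theorem cyc_eq_zero_iff {w : hyperoctahedral n} : cyc w = 0 ↔ w = 1 := by
  rw [cyc, Finset.card_eq_zero, Equiv.Perm.cycleFactorsFinset_eq_empty_iff]
  exact OneMemClass.coe_eq_one

theorem cyc_eq_one_iff {w : hyperoctahedral n} : cyc w = 1 ↔ w.1.IsCycle := by
  rw [cyc, Finset.card_eq_one]
  exact ⟨fun ⟨_, h⟩ => (Equiv.Perm.cycleFactorsFinset_eq_singleton_iff.1 h).1,
    fun h => ⟨_, h.cycleFactorsFinset_eq_singleton⟩⟩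

variable [NeZero n] {w : hyperoctahedral n}

theorem sameCycle_piT_inv_apply (w : hyperoctahedral n) (p : SignedPt n) :
    (piT w).1.SameCycle ((w⁻¹).1 p) p := by
  obtain ⟨x, rfl⟩ := ofInt_surjective p
  obtain ⟨y, hy⟩ := ofInt_surjective ((w⁻¹).1 (ofInt x))
  rw [← hy, (rot_piT w).sameCycle_iff (isNC_ncClosure w)]
  exact ncClosure_of_apply (inv_apply_eq_iff.1 hy.symm).symm

theorem piT_apply_inv_apply_of_eq {p : SignedPt n} (h : (w⁻¹).1 p = p) :
    (piT w).1 ((w⁻¹).1 p) = p := by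
  rw [h]
  exact piT_apply_eq_self_iff.2 (inv_apply_eq_iff.1 h).symm

theorem lt_inv_apply_iff {p : SignedPt n} : p < (w⁻¹).1 p ↔
    p < ((pop w)⁻¹).1 p ∨ (piT w).1 ((w⁻¹).1 p) < (w⁻¹).1 p := by
  have hE := isNC_ncClosure w
  have hv := rot_piT w
  have same := sameCycle_piT_inv_apply w p
  rw [pop_inv_apply]
  rcases lt_trichotomy p ((w⁻¹).1 p) with h | h | h
  · exact iff_of_true h ((lt_or_ge _ _).symm.imp_left h.trans_le)
  · rw [piT_apply_inv_apply_of_eq h.symm, ← h, or_self]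
  · refine iff_of_false h.not_gt (not_or.2 ⟨?_, fun h' => ?_⟩)
    · exact (hv.lt_and_le_of_lt hE same h).2.not_gt
    · exact (hv.le_of_apply_le hE h'.le same).not_gt h

theorem not_lt_pop_inv_apply {p : SignedPt n} (h : (piT w).1 ((w⁻¹).1 p) < (w⁻¹).1 p) :
    ¬ p < ((pop w)⁻¹).1 p := by
  have hE := isNC_ncClosure w
  exact ((rot_piT w).apply_le_of_isMax hE (fun _ => (rot_piT w).le_of_apply_le hE h.le)
    (sameCycle_piT_inv_apply w p)).not_gt

theorem aexc_eq_add_cyc (w : hyperoctahedral n) : aexc w = aexc (pop w) + cyc (piT w) := by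
  have descents : (Finset.univ.filter fun p => (piT w).1 ((w⁻¹).1 p) < (w⁻¹).1 p).card
      = cyc (piT w) := by
    rw [← (rot_piT w).card_descents (isNC_ncClosure w)]
    exact Finset.card_equiv (w⁻¹).1 fun p => by simp only [Finset.mem_filter_univ]
  rw [← descents]
  unfold aexc
  rw [← Finset.card_union_of_disjoint, ← Finset.filter_or]
  · exact congrArg _ (Finset.filter_congr fun p _ => lt_inv_apply_iff)
  · exact Finset.disjoint_filter.2 fun p _ h h' => not_lt_pop_inv_apply h' h

theorem piT_eq_one_iff : piT w = 1 ↔ w = 1 := by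
  constructor
  · intro h
    exact ext_apply fun p => piT_apply_eq_self_iff.1 (by rw [h]; rfl)
  · rintro rfl
    exact ext_apply fun p => piT_apply_eq_self_iff.2 rfl

theorem pop_eq_self_iff : pop w = w ↔ w = 1 := by
  rw [← piT_eq_one_iff, ← inv_eq_one, ← mul_eq_left (a := w)]
  rfl

theorem aexc_pop_lt (w : hyperoctahedral n) (hw : pop w ≠ w) : aexc (pop w) < aexc w := by
  have : cyc (piT w) ≠ 0 := by rwa [ne_eq, cyc_eq_zero_iff, piT_eq_one_iff, ← pop_eq_self_iff]
  have := aexc_eq_add_cyc w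
  omega

end Pop

section WidestGap

variable {E : Setoid ℤ}

theorem exists_widest_gap (h : ∃ x z, IsNext E x z ∧ z < x + 2 * n) :
    ∃ b c, (IsNext E b c ∧ c < b + 2 * n) ∧
      ∀ x z, IsNext E x z → z < x + 2 * n → z - x ≤ c - b := by
  obtain ⟨x₀, z₀, hz₀, hlt₀⟩ := h
  obtain ⟨d, ⟨b, c, hbc, hlt, rfl⟩, max⟩ := Int.exists_greatest_of_bdd
    (P := fun d => ∃ x z, IsNext E x z ∧ z < x + 2 * n ∧ z - x = d)
    ⟨2 * n, by rintro _ ⟨x, z, -, hlt, rfl⟩; omega⟩ ⟨_, x₀, z₀, hz₀, hlt₀, rfl⟩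
  exact ⟨b, c, ⟨hbc, hlt⟩, fun x z hz hlt => max _ ⟨x, z, hz, hlt, rfl⟩⟩

variable (hE : IsNC n E) {b c : ℤ}

include hE

theorem IsNC.rel_of_widest_gap (hbc : IsNext E b c)
    (max : ∀ x z, IsNext E x z → z < x + 2 * n → z - x ≤ c - b)
    {p : ℤ} (hcp : c - 2 * n < p) (hpb : p ≤ b) (hp : ¬ IsNext E p (p + 2 * n)) : E b p := by
  by_contra hnot
  -- A gap of the block of `p` that contains `b` contains the whole gap from `b` to `c`.
  obtain ⟨x, ⟨hxb, hpx⟩, greatest⟩ := Int.exists_greatest_of_bdd (P := fun x => x ≤ b ∧ E p x)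
    ⟨b, fun _ hx => hx.1⟩ ⟨p, hpb, E.refl p⟩
  obtain ⟨z, hz, hzx⟩ := exists_isNext_of_lt (lt_add_of_pos_right x (show (0 : ℤ) < 2 * n by
    have := hbc.lt; omega)) (hE.period x)
  have hle := greatest p ⟨hpb, E.refl p⟩
  have hxb : x < b := hxb.lt_of_ne (by rintro rfl; exact hnot (E.symm hpx))
  have hcz : c < z := (hE.le_or_lt_of_isNext hz hbc.rel hxb hbc.lt (by omega)).resolve_left
    fun hzb => (greatest z ⟨hzb, E.trans hpx hz.rel⟩).not_gt hz.lt
  have := hbc.lt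
  rcases hzx.lt_or_eq with hlt | rfl
  · have := max x z hz hlt
    omega
  · have hxp : x = p := by
      by_contra hne
      have := hz.le (y := p + 2 * n) (by omega) (hE.add_two_mul_right_iff.2 (E.symm hpx))
      omega
    exact hp (hxp ▸ hz)

variable [NeZero n]

theorem IsNC.exists_interval_block {x y : ℤ} (hx : ¬ IsNext E x (x + 2 * n))
    (hy : ¬ IsNext E y (y + 2 * n)) (hxy : ¬ E x y) : ∃ b c, IsNext E b c ∧ b + n < c ∧
      c < b + 2 * n ∧ ∀ p, c - 2 * n < p → p ≤ b → ¬ IsNext E p (p + 2 * n) → E b p := by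
  obtain ⟨z, hz, hzx⟩ := hE.exists_isNext x
  obtain ⟨b, c, ⟨hbc, hlt⟩, max⟩ := exists_widest_gap
    ⟨x, z, hz, hzx.lt_of_ne (by rintro rfl; exact hx hz)⟩
  have interval (p : ℤ) := hE.rel_of_widest_gap hbc max (p := p)
  refine ⟨b, c, hbc, ?_, hlt, interval⟩
  by_contra! hcb
  have nontrivial_shift {p : ℤ} :
      ¬ IsNext E (p + n) (p + n + 2 * n) ↔ ¬ IsNext E p (p + 2 * n) := by
    rw [add_right_comm, hE.isNext_shift_iff]
  have balanced : E b (b + n) := by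
    rcases hcb.eq_or_lt with rfl | hcb
    · exact hbc.rel
    · have hb : ¬ IsNext E b (b + 2 * n) := fun h => hlt.ne (hbc.unique h)
      have := interval (b - n) (by omega) (by omega)
        (by rwa [← nontrivial_shift, sub_add_cancel])
      rw [← hE.shift_iff, sub_add_cancel] at this
      exact E.symm this
  have all : ∀ p, ¬ IsNext E p (p + 2 * n) → E b p :=
    forall_of_forall_half (n := n) (fun p => by
      rw [nontrivial_shift, ← hE.shift_iff (x := b) (y := p)]
      exact imp_congr_right fun _ => ⟨E.trans (E.symm balanced), E.trans balanced⟩)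
      (b - n) fun p hp hpb => interval p (by omega) (by omega)
  exact hxy (E.trans (E.symm (all x hx)) (all y hy))

end WidestGap

section Lift

variable [NeZero n] {w : hyperoctahedral n} {x y z : ℤ}

/-- The lift of `w⁻¹` to the integers with `x < lift w x ≤ x + 2n`. -/
noncomputable def lift (w : hyperoctahedral n) (x : ℤ) : ℤ :=
  (exists_ofInt_window (x + 1) ((w⁻¹).1 (ofInt x))).choose

theorem lt_lift (w : hyperoctahedral n) (x : ℤ) : x < lift w x :=
  (exists_ofInt_window (x + 1) ((w⁻¹).1 (ofInt x))).choose_spec.1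

theorem lift_le (w : hyperoctahedral n) (x : ℤ) : lift w x ≤ x + 2 * n := by
  have := (exists_ofInt_window (x + 1) ((w⁻¹).1 (ofInt x))).choose_spec.2.1
  rw [lift]
  omega

theorem ofInt_lift (w : hyperoctahedral n) (x : ℤ) : ofInt (lift w x) = (w⁻¹).1 (ofInt x) :=
  (exists_ofInt_window (x + 1) ((w⁻¹).1 (ofInt x))).choose_spec.2.2

theorem apply_ofInt_lift (w : hyperoctahedral n) (x : ℤ) : w.1 (ofInt (lift w x)) = ofInt x :=
  (inv_apply_eq_iff.1 (ofInt_lift w x).symm).symm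

theorem lift_eq_of_ofInt_eq (hxz : x < z) (hz : z ≤ x + 2 * n)
    (h : ofInt z = (w⁻¹).1 (ofInt x)) : lift w x = z := by
  have := lt_lift w x
  have := lift_le w x
  exact eq_of_ofInt_eq ((ofInt_lift w x).trans h.symm) (by omega) (by omega)

theorem lift_add_self (w : hyperoctahedral n) (x : ℤ) : lift w (x + n) = lift w x + n := by
  have := lt_lift w x
  have := lift_le w x
  refine lift_eq_of_ofInt_eq (by omega) (by omega) ?_
  rw [ofInt_add_self, ofInt_lift, ofInt_add_self, apply_bar]

theorem lift_injective (w : hyperoctahedral n) : Function.Injective (lift w) := fun x y h => by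
  have := lt_lift w x
  have := lift_le w x
  have := lt_lift w y
  have := lift_le w y
  have heq := (apply_ofInt_lift w x).symm.trans ((congrArg _ (congrArg _ h)).trans
    (apply_ofInt_lift w y))
  exact eq_of_ofInt_eq heq (by omega) (by omega)

theorem lift_lt_iff : lift w x < x + 2 * n ↔ w.1 (ofInt x) ≠ ofInt x := by
  have hn := two_mul_pos n
  rw [(lift_le w x).lt_iff_ne, not_iff_not]
  constructor
  · intro h
    have := apply_ofInt_lift w x
    rwa [h, ofInt_add_two_mul] at this
  · intro h
    refine lift_eq_of_ofInt_eq (by omega) le_rfl ?_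
    rw [ofInt_add_two_mul]
    exact (inv_apply_eq_iff.2 h.symm).symm

theorem lift_lift_lt_iff :
    lift w (lift w x) < lift w x + 2 * n ↔ lift w x < x + 2 * n := by
  rw [lift_lt_iff, lift_lt_iff, apply_ofInt_lift, ofInt_lift, ne_comm, ne_eq, inv_apply_eq_iff,
    eq_comm]

theorem lift_add_two_mul (w : hyperoctahedral n) (x : ℤ) :
    lift w (x + 2 * n) = lift w x + 2 * n := by
  rw [two_mul, ← add_assoc, lift_add_self, lift_add_self, add_assoc]

theorem lift_lt_of_forall_between (hx : lift w x = x + 2 * n) (hy : lift w y < y + 2 * n)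
    (hfix : ∀ z, x < z → z < y → lift w z = z + 2 * n) : lift w y < x + 2 * n := by
  by_contra! hc
  have hmove : lift w (lift w y - 2 * n) < lift w y := by
    have := lift_add_two_mul w (lift w y - 2 * n)
    have := lift_lift_lt_iff.2 hy
    rw [sub_add_cancel] at *
    omega
  rcases hc.eq_or_lt with heq | hlt
  · rw [← heq, add_sub_cancel_right] at hmove
    omega
  · have := hfix (lift w y - 2 * n) (by omega) (by omega)
    omega

theorem ncClosure_lift (w : hyperoctahedral n) (x : ℤ) : ncClosure w x (lift w x) :=
  (ncClosure w).symm (ncClosure_of_apply (apply_ofInt_lift w x))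

theorem lift_lt_iff_not_isNext :
    lift w x < x + 2 * n ↔ ¬ IsNext (ncClosure w) x (x + 2 * n) := by
  rw [lift_lt_iff, ← (rot_piT w).apply_eq_self_iff (isNC_ncClosure w), piT_apply_eq_self_iff]

theorem lift_le_or_le_of_isNext {b c : ℤ} (hbc : IsNext (ncClosure w) b c)
    (h : ncClosure w b x) : lift w x ≤ b ∨ c ≤ lift w x :=
  (le_or_gt (lift w x) b).imp_right fun hb =>
    hbc.le hb ((ncClosure w).trans h (ncClosure_lift w x))

theorem lift_next {b c : ℤ} (hbc : IsNext (ncClosure w) b c) (hc : c < b + 2 * n) :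
    lift w c < c + 2 * n ∧ lift w c ≤ b + 2 * n := by
  have hE := isNC_ncClosure w
  have := hbc.lt
  have hcb : ncClosure w c (b + 2 * n) := hE.add_two_mul_right_iff.2 ((ncClosure w).symm hbc.rel)
  have hmove : lift w c < c + 2 * n := lift_lt_iff_not_isNext.2 fun h => by
    have := h.le hc hcb
    omega
  have hbc' : IsNext (ncClosure w) (b + 2 * n) (c + 2 * n) := hE.isNext_add_two_mul_iff.2 hbc
  exact ⟨hmove, (lift_le_or_le_of_isNext hbc' ((ncClosure w).symm hcb)).resolve_right
    hmove.not_ge⟩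

theorem cyc_piT_eq_one_iff : cyc (piT w) = 1 ↔ w ≠ 1 ∧
    ∀ x y, lift w x < x + 2 * n → lift w y < y + 2 * n → ncClosure w x y := by
  have same_iff {x y : ℤ} := (rot_piT w).sameCycle_iff (isNC_ncClosure w) (x := x) (y := y)
  simp only [lift_lt_iff, ← same_iff, ← piT_apply_eq_self_iff (w := w), ne_eq]
  rw [cyc_eq_one_iff, ← piT_eq_one_iff]
  constructor
  · exact fun h => ⟨fun h1 => h.ne_one (congrArg _ h1), fun x y => h.sameCycle⟩
  · rintro ⟨hw, h⟩
    obtain ⟨p, hp⟩ := exists_apply_ne hw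
    obtain ⟨x, rfl⟩ := ofInt_surjective p
    exact ⟨_, hp, ofInt_surjective.forall.2 fun y => h x y hp⟩

theorem isNext_lift_pop (hx : lift w x < x + 2 * n) :
    IsNext (ncClosure w) (lift w x) (lift (pop w) x) := by
  have hE := isNC_ncClosure w
  obtain ⟨z, hz, -⟩ := hE.exists_isNext (lift w x)
  have hxz := (lt_lift w x).trans hz.lt
  have hzx : z ≤ x + 2 * n :=
    hz.le hx (hE.add_two_mul_right_iff.2 ((ncClosure w).symm (ncClosure_lift w x)))
  rwa [lift_eq_of_ofInt_eq (w := pop w) hxz hzx]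
  rw [pop_inv_apply, ← ofInt_lift, rot_piT w _ _ hz]

theorem lift_pop_of_lift_eq (hx : lift w x = x + 2 * n) : lift (pop w) x = x + 2 * n := by
  have hn := two_mul_pos n
  have hfix : w.1 (ofInt x) = ofInt x := not_not.1 (lift_lt_iff.not.1 hx.not_lt)
  refine lift_eq_of_ofInt_eq (by omega) le_rfl ?_
  rw [ofInt_add_two_mul, pop_inv_apply, piT_apply_inv_apply_of_eq (inv_apply_eq_iff.2 hfix.symm)]

theorem lift_lt_of_lift_pop_lt (hx : lift (pop w) x < x + 2 * n) : lift w x < x + 2 * n :=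
  (lift_le w x).lt_of_ne fun h => hx.ne (lift_pop_of_lift_eq h)

end Lift

section Shuffle

variable [NeZero n] {w : hyperoctahedral n} {S : ℤ → Prop}

/-- The invariant of the orbits that have a single nontrivial block in every step: among the points
moved by `w`, the lift of `w⁻¹` only throws points of the `n`-periodic set `S` over others, and none
of them over the next point of `S`. -/
structure IsShuffle (w : hyperoctahedral n) (S : ℤ → Prop) : Prop where
  period : ∀ x, S (x + n) ↔ S x
  inversion : ∀ {x y : ℤ}, x < y → lift w x < x + 2 * n → lift w y < y + 2 * n →
    lift w y < lift w x → S x ∧ ¬ S y ∧ ∀ z, x < z → z < y → ¬ S z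
  separated : ∀ {b : ℤ}, S b → lift w b < b + 2 * n →
    ∃ p, b - n < p ∧ p < b ∧ lift w p < p + 2 * n ∧ ∃ z, b - n < z ∧ z ≤ p ∧ S z

namespace IsShuffle

variable (h : IsShuffle w S)

include h

theorem rel {x y : ℤ} (hx : lift w x < x + 2 * n) (hy : lift w y < y + 2 * n) :
    ncClosure w x y := by
  by_contra hxy
  have hE := isNC_ncClosure w
  obtain ⟨b, c, hbc, hgap, hlt, interval⟩ := hE.exists_interval_block
    (lift_lt_iff_not_isNext.1 hx) (lift_lt_iff_not_isNext.1 hy) hxy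
  have hb : lift w b < b + 2 * n := lift_lt_iff_not_isNext.2 fun h => hlt.ne (hbc.unique h)
  have hcb : c ≤ lift w b := hbc.le (lt_lift w b) (ncClosure_lift w b)
  obtain ⟨hc, hc_lift⟩ : lift w (c - n) < c - n + 2 * n ∧ lift w (c - n) ≤ b + n := by
    obtain ⟨hc, hc_lift⟩ := lift_next hbc hlt
    have := lift_add_self w (c - n)
    rw [sub_add_cancel] at this
    omega
  obtain ⟨hSb, -, not_mem⟩ := h.inversion (x := b) (y := c - n) (by omega) hb hc (by omega)
  obtain ⟨p, hbp, hpb, hp, z, hbz, hzp, hSz⟩ := h.separated hSb hb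
  have hcp : c - 2 * n ≤ p := by
    by_contra! hpc
    exact not_mem (z + n) (by omega) (by omega) ((h.period z).2 hSz)
  have hp_lift : lift w p ≤ b := by
    have hbp : ncClosure w b p := by
      rcases hcp.eq_or_lt with rfl | hcp
      · rw [← hE.add_two_mul_right_iff, sub_add_cancel]
        exact hbc.rel
      · exact interval p hcp hpb.le (lift_lt_iff_not_isNext.1 hp)
    refine (lift_le_or_le_of_isNext hbc hbp).resolve_right fun hcl => ?_
    exact (h.inversion (by omega) hp hc (by omega)).2.2 b hpb (by omega) hSb
  have hbn := lift_add_self w (b - n)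
  rw [sub_add_cancel] at hbn
  obtain ⟨-, hSp, not_mem'⟩ := h.inversion hbp (by omega) hp (by omega)
  rcases hzp.lt_or_eq with hzp | rfl
  · exact not_mem' z hbz hzp hSz
  · exact hSp hSz

theorem lift_pop_lt_lift_pop {x y : ℤ} (hx : lift w x < x + 2 * n) (hy : lift w y < y + 2 * n)
    (hlt : lift w x < lift w y) : lift (pop w) x < lift (pop w) y := by
  have hxy : ncClosure w (lift w x) (lift w y) := (ncClosure w).trans
    ((ncClosure w).symm (ncClosure_lift w x))
    ((ncClosure w).trans (h.rel hx hy) (ncClosure_lift w y))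
  exact ((isNext_lift_pop hx).le hlt hxy).trans_lt (isNext_lift_pop hy).lt

theorem inversion_of_pop {x y : ℤ} (hxy : x < y) (hx : lift w x < x + 2 * n)
    (hy : lift w y < y + 2 * n)
    (hlt : lift (Hyperoctahedral.pop w) y < lift (Hyperoctahedral.pop w) x) :
    S x ∧ ¬ S y ∧ ∀ z, x < z → z < y → ¬ S z := by
  refine h.inversion hxy hx hy (lt_of_not_ge fun hle => ?_)
  have h' := hle.lt_of_ne ((lift_injective w).ne hxy.ne)
  exact hlt.not_gt (h.lift_pop_lt_lift_pop hx hy h')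

theorem pop : IsShuffle (pop w) S where
  period := h.period
  inversion hxy hx hy :=
    h.inversion_of_pop hxy (lift_lt_of_lift_pop_lt hx) (lift_lt_of_lift_pop_lt hy)
  separated {b} hSb hb := by
    obtain ⟨p, hbp, hpb, hp, z, hbz, hzp, hSz⟩ := h.separated hSb (lift_lt_of_lift_pop_lt hb)
    rcases (lift_le (Hyperoctahedral.pop w) p).lt_or_eq with hp' | hp'
    · exact ⟨p, hbp, hpb, hp', z, hbz, hzp, hSz⟩
    -- If `p` becomes fixed, the next point `q` that is still moved takes over its role.
    obtain ⟨q, ⟨hpq, hq⟩, least⟩ := Int.exists_least_of_bdd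
      (P := fun q => p < q ∧ lift (Hyperoctahedral.pop w) q < q + 2 * n)
      ⟨p, fun q hq => hq.1.le⟩ ⟨b, hpb, hb⟩
    have hqb := least b ⟨hpb, hb⟩
    have hlt := lift_lt_of_forall_between hp' hq fun z hpz hzq => (lift_le _ z).eq_of_not_lt
      fun hz => (least z ⟨hpz, hz⟩).not_gt hzq
    have hSq := (h.inversion_of_pop hpq hp (lift_lt_of_lift_pop_lt hq) (hp' ▸ hlt)).2.1
    have hne : q ≠ b := fun h => hSq (h ▸ hSb)
    exact ⟨q, by omega, by omega, hq, z, hbz, by omega, hSz⟩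

theorem cyc_piT_eq_one (hw : w ≠ 1) : cyc (piT w) = 1 :=
  cyc_piT_eq_one_iff.2 ⟨hw, fun _ _ => h.rel⟩

theorem ncard_forwardOrbit : (forwardOrbit Hyperoctahedral.pop w).ncard = aexc w + 1 := by
  induction hm : aexc w using Nat.strong_induction_on generalizing w with
  | _ m ih =>
    by_cases hw : w = 1
    · rw [forwardOrbit_of_isFixedPt (pop_eq_self_iff.2 hw), Set.ncard_singleton, ← hm, hw,
        aexc_one]
    · have hdrop := aexc_eq_add_cyc w
      rw [h.cyc_piT_eq_one hw] at hdrop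
      rw [ncard_forwardOrbit_of_apply_ne aexc_pop_lt (pop_eq_self_iff.not.2 hw),
        ih _ (by omega) h.pop rfl]
      omega

end IsShuffle

end Shuffle

variable [NeZero n] {w : hyperoctahedral n}

section Crossing

/-- The integers below `m` that the lift of `w⁻¹` sends to `m` or beyond. -/
noncomputable def crossing (w : hyperoctahedral n) (m : ℤ) : Finset ℤ :=
  {x ∈ Finset.Ico (m - 2 * n) m | m ≤ lift w x}

theorem mem_crossing {m x : ℤ} : x ∈ crossing w m ↔ x < m ∧ m ≤ lift w x := by
  have := lift_le w x
  simp only [crossing, Finset.mem_filter, Finset.mem_Ico]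
  omega

theorem exists_lift_eq (w : hyperoctahedral n) (m : ℤ) : ∃ y < m, lift w y = m := by
  obtain ⟨y, hmy, hym, hy⟩ := exists_ofInt_window (m - 2 * n) (w.1 (ofInt m))
  exact ⟨y, by omega, lift_eq_of_ofInt_eq (by omega) (by omega) (inv_apply_eq_iff.2 hy).symm⟩

theorem card_crossing_add_one (w : hyperoctahedral n) (m : ℤ) :
    (crossing w (m + 1)).card = (crossing w m).card := by
  obtain ⟨y, hym, hy⟩ := exists_lift_eq w m
  have hmem : y ∈ crossing w m := mem_crossing.2 ⟨hym, hy.ge⟩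
  have swap : crossing w (m + 1) = insert m ((crossing w m).erase y) := by
    ext x
    have := lt_lift w x
    rw [Finset.mem_insert, Finset.mem_erase, mem_crossing, mem_crossing,
      ← (lift_injective w).ne_iff, hy]
    by_cases hxm : x = m
    · subst hxm
      omega
    · omega
  rw [swap, Finset.card_insert_of_notMem fun h =>
    (mem_crossing.1 (Finset.mem_of_mem_erase h)).1.false, Finset.card_erase_add_one hmem]

theorem card_crossing_eq (w : hyperoctahedral n) (m : ℤ) :
    (crossing w m).card = (crossing w 0).card := by
  induction m using Int.induction_on with
  | zero => rfl
  | succ k ih => rw [card_crossing_add_one, ih]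
  | pred k ih => rw [← ih, ← card_crossing_add_one, sub_add_cancel]

theorem ofInt_lt_inv_apply_iff {x : ℤ} (hx : 0 ≤ x) (hxn : x < 2 * n) :
    ofInt x < (w⁻¹).1 (ofInt x) ↔ lift w x < 2 * n := by
  have := lt_lift w x
  have := lift_le w x
  rw [← ofInt_lift]
  by_cases hlt : lift w x < 2 * n
  · rw [ofInt_lt_iff hx hxn (by omega) hlt]
    omega
  · rw [← sub_add_cancel (lift w x) (2 * n), ofInt_add_two_mul,
      ofInt_lt_iff hx hxn (by omega) (by omega)]
    omega

theorem aexc_add_card_crossing (w : hyperoctahedral n) (m : ℤ) :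
    aexc w + (crossing w m).card = 2 * n := by
  have hexc : aexc w = ({x ∈ Finset.Ico (0 : ℤ) (2 * n) | ¬ 2 * n ≤ lift w x} : Finset ℤ).card := by
    symm
    refine Finset.card_bij (fun x _ => ofInt x) ?_ ?_ ?_
    · intro x hx
      simp only [Finset.mem_filter, Finset.mem_Ico, not_le] at hx
      simpa using (ofInt_lt_inv_apply_iff hx.1.1 hx.1.2).2 hx.2
    · intro x hx y hy h
      simp only [Finset.mem_filter, Finset.mem_Ico] at hx hy
      exact eq_of_ofInt_eq h (by omega) (by omega)
    · intro p hp
      obtain ⟨x, hx, hxn, rfl⟩ := exists_ofInt_window (n := n) 0 p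
      rw [zero_add] at hxn
      simp only [Finset.mem_filter, Finset.mem_univ, true_and] at hp
      simp only [Finset.mem_filter, Finset.mem_Ico, not_le]
      exact ⟨x, ⟨⟨hx, hxn⟩, (ofInt_lt_inv_apply_iff hx hxn).1 hp⟩, rfl⟩
  have hcross : crossing w (2 * n) = {x ∈ Finset.Ico (0 : ℤ) (2 * n) | 2 * n ≤ lift w x} := by
    rw [crossing, sub_self]
  have hsplit := Finset.card_filter_add_card_filter_not (s := Finset.Ico (0 : ℤ) (2 * n))
    (fun x => 2 * n ≤ lift w x)
  rw [card_crossing_eq, ← card_crossing_eq w (2 * n), hexc, hcross]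
  simp only [Int.card_Ico, sub_zero] at hsplit
  omega

end Crossing

section Jump

/-- The integers that the lift of `w⁻¹` does not send to their successor. -/
def IsJump (w : hyperoctahedral n) (x : ℤ) : Prop := lift w x ≠ x + 1

theorem isJump_add_self {x : ℤ} : IsJump w (x + n) ↔ IsJump w x := by
  rw [IsJump, IsJump, lift_add_self]
  omega

theorem IsJump.exists_lift_eq {x : ℤ} (hx : IsJump w x) :
    ∃ s, x < s ∧ IsJump w s ∧ lift w x = s + 1 := by
  have hlt := (Int.add_one_le_of_lt (lt_lift w x)).lt_of_ne' hx
  refine ⟨lift w x - 1, by omega, fun h => hx ?_, by ring⟩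
  rwa [lift_injective w (h.trans (sub_add_cancel _ _))] at h

/-- The lift of `w⁻¹` sends no point beyond the successor of the next jump, so that it is determined
by the set of jumps. -/
def HasShortJumps (w : hyperoctahedral n) : Prop :=
  ∀ ⦃x z : ℤ⦄, x < z → IsJump w z → lift w x ≤ z + 1

theorem hasShortJumps_of_aexc (h : 2 * n ≤ aexc w + 2) : HasShortJumps w := by
  intro x z hxz hz
  by_contra! hlt
  obtain ⟨y, hyz, hy⟩ := Hyperoctahedral.exists_lift_eq w (z + 1)
  have hsub : {x, y, z} ⊆ crossing w (z + 1) := by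
    have := lt_lift w z
    simp only [Finset.insert_subset_iff, Finset.singleton_subset_iff, mem_crossing]
    omega
  have hxy : x ≠ y := by
    rintro rfl
    omega
  have hyz' : y ≠ z := by
    rintro rfl
    exact hz hy
  have hcard := Finset.card_le_card hsub
  rw [Finset.card_eq_three.2 ⟨x, y, z, hxy, hxz.ne, hyz', rfl⟩] at hcard
  have := aexc_add_card_crossing w (z + 1)
  omega

theorem HasShortJumps.aexc_add_two (h : HasShortJumps w) {b : ℤ} (hb : IsJump w b) :
    aexc w + 2 = 2 * n := by
  obtain ⟨y, hyb, hy⟩ := Hyperoctahedral.exists_lift_eq w (b + 1)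
  have hyb' : y ≠ b := by
    rintro rfl
    exact hb hy
  have hcross : crossing w (b + 1) = {y, b} := by
    ext x
    have := lt_lift w x
    rw [mem_crossing, Finset.mem_insert, Finset.mem_singleton, ← (lift_injective w).eq_iff, hy]
    have hle : x < b → lift w x ≤ b + 1 := fun hxb => h hxb hb
    by_cases hxb : x = b
    · subst hxb
      omega
    · omega
  have := aexc_add_card_crossing w (b + 1)
  rwa [hcross, Finset.card_pair hyb'] at this

theorem aexc_add_one_of_forall_not_isJump (h : ∀ x, ¬ IsJump w x) : aexc w + 1 = 2 * n := by
  have hcross : crossing w 1 = {0} := by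
    ext x
    rw [mem_crossing, Finset.mem_singleton, not_not.1 (h x)]
    omega
  have := aexc_add_card_crossing w 1
  rwa [hcross, Finset.card_singleton] at this

theorem HasShortJumps.isShuffle (h : HasShortJumps w)
    (hsep : ∀ b, IsJump w b → ∃ z, b - n < z ∧ z < b ∧ IsJump w z) : IsShuffle w (IsJump w) where
  period _ := isJump_add_self
  inversion {x y} hxy _ _ hlt := by
    have := lt_lift w y
    have not_jump : ∀ z, x < z → z ≤ y → ¬ IsJump w z := fun z hxz hzy hz => by
      have := h hxz hz
      omega
    refine ⟨fun hx => ?_, not_jump y hxy le_rfl, fun z hxz hzy => not_jump z hxz hzy.le⟩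
    omega
  separated {b} hb _ := by
    obtain ⟨z, hbz, hzb, hz⟩ := hsep b hb
    have := h hzb hb
    exact ⟨z, hbz, hzb, by omega, z, hbz, le_rfl, hz⟩

theorem inv_eq_coxeterElement_mul_refl {b : ℤ} (lift_b : lift w b = b + n + 1)
    (succ_of_between : ∀ x, b < x → x < b + n → lift w x = x + 1) :
    w⁻¹ = coxeterElement n * refl (ofInt b) (ofInt (b + n)) := by
  have hn := two_mul_pos n
  refine ext_ofInt (forall_of_forall_half (n := n) (fun x => ?_) b fun x hbx hxb => ?_)
  · rw [ofInt_add_self, apply_bar, apply_bar, bar_eq_iff, bar_bar]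
  rw [← ofInt_lift, mul_apply]
  rcases hxb.lt_or_eq with hxb | rfl
  · rw [succ_of_between x hbx hxb, refl_ofInt_of_ne (by omega) le_rfl hbx hxb hxb.ne,
      coxeterElement_ofInt]
  · rw [lift_add_self, lift_b, refl_right, coxeterElement_ofInt, ← ofInt_add_two_mul (b + 1)]
    congr 1
    ring

theorem HasShortJumps.exists_isJump_between (hn : 2 ≤ n) (h : HasShortJumps w)
    (hcyc : cyc (piT w) = 1) {b : ℤ} (hb : IsJump w b) :
    ∃ z, b - n < z ∧ z < b ∧ IsJump w z := by
  by_contra! hnot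
  have succ_of_between (x : ℤ) (hbx : b < x) (hxb : x < b + n) : lift w x = x + 1 := by
    by_contra hx
    rw [← Ne, ← IsJump, ← sub_add_cancel x n, isJump_add_self] at hx
    exact hnot _ (by omega) (by omega) hx
  have lift_b : lift w b = b + n + 1 := by
    obtain ⟨s, hbs, hs, hlift⟩ := hb.exists_lift_eq
    have := h (show b < b + n by omega) (isJump_add_self.2 hb)
    have : ¬ s < b + n := fun hsb => hs (succ_of_between s hbs hsb)
    omega
  -- The reflection cuts the cycle of the Coxeter element into two, which separates `b` from `-b`.
  have hE : IsNC n (cut n b (b + n) ⊤) := isNC_cut isNC_top (by omega)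
  have hrot : Rot (cut n b (b + n) ⊤) w⁻¹ := by
    rw [inv_eq_coxeterElement_mul_refl lift_b succ_of_between]
    exact rot_top.mul_refl isNC_top (by omega) le_rfl trivial
  have hrel : cut n b (b + n) ⊤ (b + n) (b + 2 * n) := by
    refine ncClosure_le hE (fun x y hxy => ?_) ((cyc_piT_eq_one_iff.1 hcyc).2 _ _ ?_ ?_)
    · exact (cut n b (b + n) ⊤).symm (hrot.rel hE (inv_apply_eq_iff.2 hxy.symm))
    · rw [lift_add_self]
      omega
    · rw [lift_add_two_mul]
      omega
  rw [cut_iff_two_turns (by omega) (by omega) (by omega) (by omega) (by omega)] at hrel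
  omega

theorem isSplittable_iff (hn : 2 ≤ n) : IsSplittable w ↔ HasShortJumps w ∧ (∃ b, IsJump w b) ∧
    ∀ b, IsJump w b → ∃ z, b - n < z ∧ z < b ∧ IsJump w z := by
  constructor
  · rintro ⟨haexc, hcyc⟩
    have h := hasShortJumps_of_aexc haexc.ge
    refine ⟨h, ?_, fun b => h.exists_isJump_between hn hcyc⟩
    by_contra! hnot
    have := aexc_add_one_of_forall_not_isJump hnot
    omega
  · rintro ⟨h, ⟨b, hb⟩, hsep⟩
    have haexc := h.aexc_add_two hb
    refine ⟨haexc, (h.isShuffle hsep).cyc_piT_eq_one ?_⟩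
    rintro rfl
    rw [aexc_one] at haexc
    omega

theorem cyc_piT_eq_one_of_ncard (hw : w ≠ 1) (h : (forwardOrbit pop w).ncard = aexc w + 1) :
    cyc (piT w) = 1 := by
  have hcyc : cyc (piT w) ≠ 0 := by rwa [ne_eq, cyc_eq_zero_iff, piT_eq_one_iff]
  have hdrop := aexc_eq_add_cyc w
  have := ncard_forwardOrbit_le aexc_pop_lt (pop w)
  rw [ncard_forwardOrbit_of_apply_ne aexc_pop_lt (pop_eq_self_iff.not.2 hw)] at h
  omega

theorem ncard_forwardOrbit_eq_iff (hn : 2 ≤ n) (w : hyperoctahedral n) :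
    (forwardOrbit pop w).ncard = 2 * n - 1 ↔ IsSplittable w := by
  constructor
  · intro horbit
    have hle := ncard_forwardOrbit_le aexc_pop_lt w
    have hshort : HasShortJumps w := hasShortJumps_of_aexc (by omega)
    have haexc : aexc w + 2 = 2 * n := by
      by_cases hjump : ∃ b, IsJump w b
      · exact hshort.aexc_add_two hjump.choose_spec
      · push Not at hjump
        have := aexc_add_one_of_forall_not_isJump hjump
        have := (hshort.isShuffle fun b hb => absurd hb (hjump b)).ncard_forwardOrbit
        omega
    refine ⟨haexc, cyc_piT_eq_one_of_ncard ?_ (by omega)⟩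
    rintro rfl
    rw [aexc_one] at haexc
    omega
  · intro h
    obtain ⟨hshort, -, hsep⟩ := (isSplittable_iff hn).1 h
    have := (hshort.isShuffle hsep).ncard_forwardOrbit
    have := h.1
    omega

end Jump

section JumpSet

variable {u : hyperoctahedral n}

theorem HasShortJumps.lift_le_lift (hu : HasShortJumps u) (h : ∀ x, IsJump u x ↔ IsJump w x)
    (x : ℤ) : lift u x ≤ lift w x := by
  by_cases hx : IsJump u x
  · obtain ⟨s, hxs, hs, hlift⟩ := ((h x).1 hx).exists_lift_eq
    exact (hu hxs ((h s).2 hs)).trans_eq hlift.symm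
  · exact (not_not.1 hx).trans_le (lt_lift w x)

theorem HasShortJumps.eq_of_isJump_iff (hu : HasShortJumps u) (hw : HasShortJumps w)
    (h : ∀ x, IsJump u x ↔ IsJump w x) : u = w := by
  refine inv_injective (ext_ofInt fun x => ?_)
  rw [← ofInt_lift, ← ofInt_lift, (hu.lift_le_lift h x).antisymm
    (hw.lift_le_lift (fun y => (h y).symm) x)]

theorem exists_isNext_blockSetoid {S : ℤ → Prop} (hS : ∀ x, S (x + n) ↔ S x) {x : ℤ} (hx : S x) :
    ∃ s, IsNext (blockSetoid n S) x s ∧ s ≤ x + n ∧ ∀ z, x < z → S z → s ≤ z := by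
  have hn := two_mul_pos n
  obtain ⟨s, hs, -⟩ := (isNC_blockSetoid hS).exists_isNext x
  have le_of_mem (z : ℤ) (hxz : x < z) (hz : S z) : s ≤ z :=
    hs.le hxz (blockSetoid_iff.2 (Or.inl ⟨hx, hz⟩))
  exact ⟨s, hs, le_of_mem _ (by omega) ((hS x).2 hx), le_of_mem⟩

theorem isNext_blockSetoid_of_not {S : ℤ → Prop} (hS : ∀ x, S (x + n) ↔ S x) {x : ℤ}
    (hx : ¬ S x) : IsNext (blockSetoid n S) x (x + 2 * n) := by
  refine ⟨lt_add_of_pos_right x (two_mul_pos n), ?_, fun z hxz hzx hE => ?_⟩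
  · refine blockSetoid_iff.2 (Or.inr ⟨hx, ?_, (ofInt_add_two_mul x).symm⟩)
    rwa [two_mul, ← add_assoc, hS, hS]
  · rcases blockSetoid_iff.1 hE with ⟨hSx, -⟩ | ⟨-, -, heq⟩
    · exact hx hSx
    · exact hxz.ne (eq_of_ofInt_eq heq (by omega) (by omega))

theorem exists_hasShortJumps {S : ℤ → Prop} (hS : ∀ x, S (x + n) ↔ S x) :
    ∃ w : hyperoctahedral n, HasShortJumps w ∧ ∀ x, IsJump w x ↔ S x := by
  have hn := two_mul_pos n
  obtain ⟨v, hv⟩ := (isNC_blockSetoid hS).exists_rot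
  -- `w⁻¹` is the rotation with the single block `S`, followed by the Coxeter element.
  obtain ⟨w, rfl⟩ : ∃ w, v = (coxeterElement n)⁻¹ * w⁻¹ := ⟨(coxeterElement n * v)⁻¹, by group⟩
  have inv_apply {x s : ℤ} (hs : IsNext (blockSetoid n S) x s) :
      ofInt (s + 1) = (w⁻¹).1 (ofInt x) := by
    rw [← coxeterElement_ofInt, ← hv x s hs, ← mul_apply, mul_inv_cancel_left]
  have lift_of_mem {x : ℤ} (hx : S x) :
      ∃ s, x < s ∧ lift w x = s + 1 ∧ ∀ z, x < z → S z → s ≤ z := by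
    obtain ⟨s, hs, hsx, le_of_mem⟩ := exists_isNext_blockSetoid hS hx
    have hxs := hs.lt
    exact ⟨s, hxs, lift_eq_of_ofInt_eq (by omega) (by omega) (inv_apply hs), le_of_mem⟩
  have lift_of_not {x : ℤ} (hx : ¬ S x) : lift w x = x + 1 := by
    refine lift_eq_of_ofInt_eq (by omega) (by omega) ?_
    rw [← inv_apply (isNext_blockSetoid_of_not hS hx), add_right_comm, ofInt_add_two_mul]
  have isJump_iff (x : ℤ) : IsJump w x ↔ S x := by
    refine ⟨fun hx => by_contra fun hSx => hx (lift_of_not hSx), fun hx => ?_⟩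
    obtain ⟨s, hxs, hlift, -⟩ := lift_of_mem hx
    rw [IsJump]
    omega
  refine ⟨w, fun x z hxz hz => ?_, isJump_iff⟩
  by_cases hx : S x
  · obtain ⟨s, -, hlift, le_of_mem⟩ := lift_of_mem hx
    have := le_of_mem z hxz ((isJump_iff z).1 hz)
    omega
  · rw [lift_of_not hx]
    omega

end JumpSet

section Counting

theorem two_le_card_iff {s : Finset (ZMod n)} : 2 ≤ s.card ↔
    (∃ b : ℤ, (b : ZMod n) ∈ s) ∧
      ∀ b : ℤ, (b : ZMod n) ∈ s → ∃ z : ℤ, b - n < z ∧ z < b ∧ (z : ZMod n) ∈ s := by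
  have hn : (0 : ℤ) < n := mod_cast NeZero.pos n
  constructor
  · intro hs
    refine ⟨?_, fun b _ => ?_⟩
    · obtain ⟨a, ha⟩ := Finset.card_pos.1 (Nat.zero_lt_two.trans_le hs)
      obtain ⟨b, rfl⟩ := ZMod.intCast_surjective a
      exact ⟨b, ha⟩
    · obtain ⟨a, ha, hab⟩ := Finset.exists_mem_ne hs (b : ZMod n)
      obtain ⟨y, rfl⟩ := ZMod.intCast_surjective a
      have hlt := Int.emod_lt_of_pos (b - y) hn
      have hpos : (b - y) % n ≠ 0 := fun h => hab <| by
        rw [ZMod.intCast_eq_intCast_iff_dvd_sub]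
        exact Int.dvd_of_emod_eq_zero h
      have := Int.emod_nonneg (b - y) hn.ne'
      exact ⟨b - (b - y) % n, by omega, by omega, by simpa using ha⟩
  · rintro ⟨⟨b, hb⟩, hsep⟩
    obtain ⟨z, hbz, hzb, hz⟩ := hsep b hb
    refine Finset.one_lt_card.2 ⟨b, hb, z, hz, fun h => ?_⟩
    have := Int.eq_zero_of_abs_lt_dvd ((ZMod.intCast_eq_intCast_iff_dvd_sub _ _ _).1 h)
      (abs_lt.2 ⟨by omega, by omega⟩)
    omega

open Classical in
/-- The classes modulo `n` of the jumps of `w`. -/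
noncomputable def jumpSet (w : hyperoctahedral n) : Finset (ZMod n) :=
  {a | ∃ x : ℤ, (x : ZMod n) = a ∧ IsJump w x}

theorem mem_jumpSet {x : ℤ} : (x : ZMod n) ∈ jumpSet w ↔ IsJump w x := by
  simp only [jumpSet, Finset.mem_filter, Finset.mem_univ, true_and]
  refine ⟨fun ⟨y, hyx, hy⟩ => ?_, fun hx => ⟨x, rfl, hx⟩⟩
  have periodic : Function.Periodic (IsJump w) n := fun _ => propext isJump_add_self
  obtain ⟨k, hk⟩ := (ZMod.intCast_eq_intCast_iff_dvd_sub _ _ _).1 hyx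
  rwa [show x = y + k • (n : ℤ) by rw [smul_eq_mul]; linarith, periodic.zsmul k y]

theorem isSplittable_iff_card_jumpSet (hn : 2 ≤ n) :
    IsSplittable w ↔ HasShortJumps w ∧ 2 ≤ (jumpSet w).card := by
  simp only [isSplittable_iff hn, two_le_card_iff, mem_jumpSet]

theorem jumpSet_injOn : Set.InjOn jumpSet {w : hyperoctahedral n | HasShortJumps w} :=
  fun _ hu _ hw h => hu.eq_of_isJump_iff hw fun x => by rw [← mem_jumpSet, h, mem_jumpSet]

theorem exists_jumpSet_eq (s : Finset (ZMod n)) :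
    ∃ w : hyperoctahedral n, HasShortJumps w ∧ jumpSet w = s := by
  obtain ⟨w, hw, hjump⟩ := exists_hasShortJumps (n := n) (S := fun x => (x : ZMod n) ∈ s)
    fun x => by simp
  refine ⟨w, hw, Finset.ext fun a => ?_⟩
  obtain ⟨x, rfl⟩ := ZMod.intCast_surjective a
  rw [mem_jumpSet, hjump]

theorem card_filter_two_le_card (α : Type*) [Fintype α] :
    ({s | 2 ≤ s.card} : Finset (Finset α)).card =
      2 ^ Fintype.card α - Fintype.card α - 1 := by
  have hsplit := Finset.card_filter_add_card_filter_not (s := (Finset.univ : Finset (Finset α)))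
    (fun s => 2 ≤ s.card)
  have hsmall : ({s | ¬ 2 ≤ s.card} : Finset (Finset α)) =
      (Finset.powersetCard 0 Finset.univ).disjUnion (Finset.powersetCard 1 Finset.univ)
        (Finset.pairwise_disjoint_powersetCard _ zero_ne_one) := by
    ext s
    simp only [Finset.mem_filter, Finset.mem_univ, true_and, Finset.mem_disjUnion,
      Finset.mem_powersetCard, Finset.subset_univ]
    omega
  rw [hsmall, Finset.card_disjUnion, Finset.card_powersetCard, Finset.card_powersetCard,
    Finset.card_univ, Finset.card_univ, Fintype.card_finset, Nat.choose_zero_right,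
    Nat.choose_one_right] at hsplit
  omega

theorem ncard_isSplittable (hn : 2 ≤ n) :
    {w : hyperoctahedral n | IsSplittable w}.ncard = 2 ^ n - n - 1 := by
  have himage : jumpSet '' {w : hyperoctahedral n | IsSplittable w} =
      ({s | 2 ≤ s.card} : Finset (Finset (ZMod n))) := by
    ext s
    simp only [isSplittable_iff_card_jumpSet hn, Set.mem_image, Set.mem_ofPred_eq,
      Finset.coe_filter, Finset.mem_univ, true_and]
    constructor
    · rintro ⟨w, ⟨-, hcard⟩, rfl⟩
      exact hcard
    · obtain ⟨w, hw, rfl⟩ := exists_jumpSet_eq s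
      exact fun hcard => ⟨w, ⟨hw, hcard⟩, rfl⟩
  have hinj : Set.InjOn jumpSet {w : hyperoctahedral n | IsSplittable w} :=
    jumpSet_injOn.mono fun w hw => ((isSplittable_iff_card_jumpSet hn).1 hw).1
  rw [← hinj.ncard_image, himage, Set.ncard_coe_finset, card_filter_two_le_card, ZMod.card]

end Counting

end Hyperoctahedral

theorem theorem1p6 (n : ℕ) (hn : 2 ≤ n) :
    (∀ w : hyperoctahedral n,
      (forwardOrbit Hyperoctahedral.pop w).ncard = 2 * n - 1 ↔ Hyperoctahedral.IsSplittable w) ∧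
    {w : hyperoctahedral n |
      (forwardOrbit Hyperoctahedral.pop w).ncard = 2 * n - 1}.ncard = 2 ^ n - n - 1 := by
  have : NeZero n := ⟨by omega⟩
  refine ⟨Hyperoctahedral.ncard_forwardOrbit_eq_iff hn, ?_⟩
  simp only [Hyperoctahedral.ncard_forwardOrbit_eq_iff hn]
  exact Hyperoctahedral.ncard_isSplittable hn
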